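/- Let $(X_t)_{t\in\mathbb Z}$ be a stationary real-valued first-order Markov process on a probability space $(\Omega,\mathcal F,\mathbb P)$. For $a\ge 1$ let $$\beta(a)=\sup_t\big\|\mathbb P_{-\infty}^t\otimes\mathbb P_{t+a}^\infty-\mathbb P_{t,a}\big\|_{TV},\qquad \beta^1(a)=\big\|\mathbb P_{X_t}\otimes\mathbb P_{X_{t+a}}-\mathbb P_{(X_t,X_{t+a})}\big\|_{TV},$$ where $\mathbb P_{-\infty}^t$, $\mathbb P_{t+a}^\infty$ are the laws of $(X_s)_{s\le t}$ and $(X_s)_{s\ge t+a}$, $\mathbb P_{t,a}$ is their joint law, and $\|\mu-\nu\|_{TV}=\sup_C|\mu(C)-\nu(C)|$. Suppose that $\beta(a)=O(a^{-r})$ as $a\to\infty$ for some $r>0$. Fix $a\ge1$ and assume that $(X_0,X_a)$ has a density on $\mathbb R^2$ with respect to Lebesgue measure. For a bin width $h>0$ and a grid origin $c\in\mathbb R$, partition $\mathbb R$ into the bins $[c+kh,c+(k+1)h)$, $k\in\mathbb Z$, and write $B(x)$ for the bin that contains $x$. From the sample $X_1,\dots,X_n$ (with $n>a$) form the histograms $$\widehat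 f^1(x)=\frac1{nh}\sum_{i=1}^n \mathbf 1\{X_i\in B(x)\},\qquad \widehat f_a^2(x,y)=\frac1{(n-a)h^2}\sum_{i=1}^{n-a}\mathbf 1\{X_i\in B(x),\,X_{i+a}\in B(y)\}$$ and the estimator $\widehat\beta^1(a)=\frac12\int_{\mathbb R^2}\big|\widehat f_a^2(x,y)-\widehat f^1(x)\widehat f^1(y)\big|\,dx\,dy$. Then $\beta(b)=\beta^1(b)$ for every $b\ge1$ (whatever $t$ is used in $\beta^1$), and $\widehat\beta^1(a)$ converges in probability to $\beta(a)$ in each of the following two situations. (i) The sample size $n$ tends to infinity through all the integers, and the bin widths $h_n>0$ (with arbitrary origins $c_n$) satisfy $h_n\to0$ and $nh_n^2\to\infty$. (ii) The sample sizes are $n_k=2\mu_km_k$, $k\to\infty$, with numbers of blocks $\mu_k\ge 1$ and block lengths $m_k\ge 1$ that are integers with $m_k<n_k^{1/(1+r)}$, and the bin widths $h_k>0$ (with arbitrary origins $c_k$) satisfy $h_k\to0$ and $\mu_kh_k^2\to\infty$. -/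

import Mathlib

open MeasureTheory Filter Topology Asymptotics

namespace BetaMixing

variable {Ω : Type*} [MeasurableSpace Ω]

/-- Total variation distance of two probability measures: `sup_C |μ(C) - ν(C)|` over measurable
`C`; for measures with densities `f`, `g` this is `(1/2) ∫ |f - g|`. -/
noncomputable def tv {α : Type*} [MeasurableSpace α] (μ ν : Measure α) : ℝ :=
  ⨆ C : {C : Set α // MeasurableSet C}, |μ.real C.1 - ν.real C.1|

/-- The block `(X_s)_{s ≤ t}`. -/
def past (X : ℤ → Ω → ℝ) (t : ℤ) (ω : Ω) : Set.Iic t → ℝ := fun s => X s.1 ω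

/-- The block `(X_s)_{s ≥ t}`. -/
def future (X : ℤ → Ω → ℝ) (t : ℤ) (ω : Ω) : Set.Ici t → ℝ := fun s => X s.1 ω

/-- The `β`-mixing coefficient (coefficient of absolute regularity) of `X` at lag `a`. -/
noncomputable def beta (X : ℤ → Ω → ℝ) (P : Measure Ω) (a : ℕ) : ℝ :=
  ⨆ t : ℤ, tv ((P.map (past X t)).prod (P.map (future X (t + a))))
    (P.map (fun ω => (past X t ω, future X (t + a) ω)))

/-- The one-dimensional coefficient `β¹(a)`, computed at time `t`: the total variation distance
between the product of the laws of `X_t` and `X_{t+a}` and their joint law. -/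
noncomputable def betaOne (X : ℤ → Ω → ℝ) (P : Measure Ω) (t : ℤ) (a : ℕ) : ℝ :=
  tv ((P.map (X t)).prod (P.map (X (t + a)))) (P.map (fun ω => (X t ω, X (t + a) ω)))

/-- Stationarity: `(X_t, …, X_{t+i})` and `(X_{t+j}, …, X_{t+i+j})` have the same law. -/
def IsStationary (X : ℤ → Ω → ℝ) (P : Measure Ω) : Prop :=
  ∀ (t : ℤ) (i j : ℕ),
    P.map (fun ω (k : Fin (i + 1)) => X (t + (k : ℕ)) ω) =
      P.map (fun ω (k : Fin (i + 1)) => X (t + j + (k : ℕ)) ω)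

/-- First-order Markov property: for every time `t` and every event `A` of the future
`σ(X_s, s ≥ t)`, the conditional probabilities of `A` given the past `σ(X_s, s ≤ t)` and given
the present `σ(X_t)` agree almost surely. -/
def IsMarkov (X : ℤ → Ω → ℝ) (P : Measure Ω) : Prop :=
  ∀ (t : ℤ) (A : Set Ω),
    MeasurableSet[⨆ s : Set.Ici t, MeasurableSpace.comap (X s.1) inferInstance] A →
      P[A.indicator (fun _ => (1 : ℝ)) |
          ⨆ s : Set.Iic t, MeasurableSpace.comap (X s.1) inferInstance] =ᵐ[P]
        P[A.indicator (fun _ => (1 : ℝ)) | MeasurableSpace.comap (X t) inferInstance]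

/-- Index of the bin `[c + k h, c + (k + 1) h)` that contains `x`. -/
noncomputable def bin (c h x : ℝ) : ℤ := ⌊(x - c) / h⌋

/-- Histogram estimator of the density of one observation from `X_1, …, X_n`, on the grid
with origin `c` and bin width `h`. -/
noncomputable def histOne (X : ℤ → Ω → ℝ) (c h : ℝ) (n : ℕ) (ω : Ω) (x : ℝ) : ℝ :=
  ((n : ℝ) * h)⁻¹ *
    ∑ i ∈ Finset.Icc 1 n, if bin c h (X (i : ℤ) ω) = bin c h x then (1 : ℝ) else 0

/-- Histogram estimator of the joint density of two observations `a` time points apart, from the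
`n - a` pairs `(X_i, X_{i+a})` available in `X_1, …, X_n`, on the square grid with origin `(c, c)`
and side `h`. -/
noncomputable def histTwo (X : ℤ → Ω → ℝ) (c h : ℝ) (a n : ℕ) (ω : Ω) (z : ℝ × ℝ) : ℝ :=
  (((n - a : ℕ) : ℝ) * h ^ 2)⁻¹ *
    ∑ i ∈ Finset.Icc 1 (n - a),
      if bin c h (X (i : ℤ) ω) = bin c h z.1 ∧ bin c h (X ((i : ℤ) + a) ω) = bin c h z.2
      then (1 : ℝ) else 0

/-- The estimator of `β¹(a)` from `X_1, …, X_n`: half the `L¹` distance between the joint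
histogram and the product of the marginal histograms. -/
noncomputable def betaHat (X : ℤ → Ω → ℝ) (c h : ℝ) (a n : ℕ) (ω : Ω) : ℝ :=
  (1 / 2) * ∫ z : ℝ × ℝ, |histTwo X c h a n ω z - histOne X c h n ω z.1 * histOne X c h n ω z.2|

end BetaMixing

/-! Identity. By the Markov property, a past block and a later future block interact only through
their end points: one and the same kernel, drawing the two blocks independently given the end
points, produces both the joint law of the blocks and the product of their laws
(`map_past_future_eq_bind`, `beta_term_eq_betaOne`). Neither a Markov kernel (`tv_bind_le`) nor the
projection back to the end points increases total variation, so the block coefficient equals the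
two-point one.

Consistency. The integrand is constant on grid cells, so the estimator is an `ℓ¹` distance of
empirical cell frequencies (`betaHat_eq_tsum`). Its population version tends to the total variation
distance as the mesh vanishes, by regularity of finite measures (`tendsto_half_tsum_abs`). For the
random error, fix a gap `m` and split each cell indicator into its conditional probability given the
past `m` steps earlier and a remainder. Remainders are uncorrelated at distance `m + a`; a second
moment bound and Cauchy–Schwarz over `K` cells give `√(4(m+a)K/n)`. The conditional probabilities
deviate from the cell probabilities by at most `2β(m)` in mean, summed over all cells, with no
factor `K` (`sum_integral_abs_condExp_sub_le`). Cells off a box of side `2R` cost only tail mass. As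
`K` is of order `(R/h)²`, fixing `m` and `R` first and letting `n h² → ∞` removes the rest. -/

namespace BetaMixing

open ProbabilityTheory Set

/-! ### Total variation distance and data processing -/

section TotalVariation

variable {α β : Type*} [MeasurableSpace α] [MeasurableSpace β]

lemma abs_real_sub_real_le_one (μ ν : Measure α) [IsProbabilityMeasure μ] [IsProbabilityMeasure ν]
    (C : Set α) : |μ.real C - ν.real C| ≤ 1 := by
  have h1 : μ.real C ≤ 1 := measureReal_le_one
  have h2 : ν.real C ≤ 1 := measureReal_le_one
  have h3 : 0 ≤ μ.real C := measureReal_nonneg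
  have h4 : 0 ≤ ν.real C := measureReal_nonneg
  rw [abs_le]; constructor <;> linarith

lemma bddAbove_tv (μ ν : Measure α) [IsProbabilityMeasure μ] [IsProbabilityMeasure ν] :
    BddAbove (range fun C : {C : Set α // MeasurableSet C} => |μ.real C.1 - ν.real C.1|) :=
  ⟨1, by rintro _ ⟨C, rfl⟩; exact abs_real_sub_real_le_one μ ν C.1⟩

lemma abs_real_sub_real_le_tv (μ ν : Measure α) [IsProbabilityMeasure μ] [IsProbabilityMeasure ν]
    {C : Set α} (hC : MeasurableSet C) : |μ.real C - ν.real C| ≤ tv μ ν :=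
  le_ciSup (bddAbove_tv μ ν) (⟨C, hC⟩ : {C : Set α // MeasurableSet C})

lemma tv_le {μ ν : Measure α} {K : ℝ}
    (h : ∀ C, MeasurableSet C → |μ.real C - ν.real C| ≤ K) : tv μ ν ≤ K :=
  have : Nonempty {C : Set α // MeasurableSet C} := ⟨⟨∅, MeasurableSet.empty⟩⟩
  ciSup_le fun C => h C.1 C.2

lemma tv_comm (μ ν : Measure α) : tv μ ν = tv ν μ := by
  simp only [tv, abs_sub_comm]

lemma tv_le_one (μ ν : Measure α) [IsProbabilityMeasure μ] [IsProbabilityMeasure ν] :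
    tv μ ν ≤ 1 := tv_le fun C _ => abs_real_sub_real_le_one μ ν C

lemma tv_map_le (μ ν : Measure α) [IsProbabilityMeasure μ] [IsProbabilityMeasure ν]
    {f : α → β} (hf : Measurable f) : tv (μ.map f) (ν.map f) ≤ tv μ ν := by
  refine tv_le fun C hC => ?_
  rw [map_measureReal_apply hf hC, map_measureReal_apply hf hC]
  exact abs_real_sub_real_le_tv μ ν (hf hC)

/-- On the Hahn set `s` where `μ ≥ ν`, replacing `f` by `1` increases the difference of integrals;
on the complement the difference is nonpositive. What remains is `μ(s) - ν(s)`. -/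
lemma integral_sub_integral_le_tv (μ ν : Measure α) [IsProbabilityMeasure μ]
    [IsProbabilityMeasure ν] {f : α → ℝ} (hf : Measurable f) (h0 : ∀ x, 0 ≤ f x)
    (h1 : ∀ x, f x ≤ 1) : ∫ x, f x ∂μ - ∫ x, f x ∂ν ≤ tv μ ν := by
  have hint : ∀ (ρ : Measure α) [IsFiniteMeasure ρ], Integrable f ρ := fun ρ _ =>
    Integrable.of_bound hf.aestronglyMeasurable 1
      (ae_of_all _ fun x => by rw [Real.norm_eq_abs, abs_of_nonneg (h0 x)]; exact h1 x)
  obtain ⟨s, hs, hνμ, hμν⟩ := hahn_decomposition (μ := μ) (ν := ν)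
  have hle : ν.restrict s ≤ μ.restrict s := Measure.le_iff.2 fun t ht => by
    rw [Measure.restrict_apply ht, Measure.restrict_apply ht]
    exact hνμ _ (ht.inter hs) inter_subset_right
  have hle' : μ.restrict sᶜ ≤ ν.restrict sᶜ := Measure.le_iff.2 fun t ht => by
    rw [Measure.restrict_apply ht, Measure.restrict_apply ht]
    exact hμν _ (ht.inter hs.compl) inter_subset_right
  have e1 : ∫ x in sᶜ, f x ∂μ ≤ ∫ x in sᶜ, f x ∂ν :=
    integral_mono_measure hle' (ae_of_all _ h0) (hint _)
  have e2 : ∫ x in s, (1 - f x) ∂ν ≤ ∫ x in s, (1 - f x) ∂μ :=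
    integral_mono_measure hle (ae_of_all _ fun x => sub_nonneg.2 (h1 x))
      ((integrable_const _).sub (hint _))
  rw [integral_sub (integrable_const _) (hint _), integral_sub (integrable_const _) (hint _)] at e2
  simp only [integral_const, smul_eq_mul, mul_one, measureReal_restrict_apply_univ] at e2
  have e3 := le_of_abs_le (abs_real_sub_real_le_tv μ ν hs)
  rw [← integral_add_compl hs (hint μ), ← integral_add_compl hs (hint ν)]
  linarith

/-- The data processing inequality: the mass that `κ` gives to a fixed event is a `[0,1]`-valued
test function. -/
lemma tv_bind_le (μ ν : Measure α) [IsProbabilityMeasure μ] [IsProbabilityMeasure ν]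
    (κ : Kernel α β) [IsMarkovKernel κ] : tv (μ.bind κ) (ν.bind κ) ≤ tv μ ν := by
  refine tv_le fun C hC => ?_
  have hm : Measurable fun x => (κ x).real C := (κ.measurable_coe hC).ennreal_toReal
  have key : ∀ (ρ : Measure α), (ρ.bind κ).real C = ∫ x, (κ x).real C ∂ρ := by
    intro ρ
    rw [measureReal_def, Measure.bind_apply hC κ.measurable.aemeasurable,
      integral_eq_lintegral_of_nonneg_ae (ae_of_all _ fun _ => measureReal_nonneg)
        hm.aestronglyMeasurable]
    congr 1
    exact lintegral_congr fun x => by rw [ofReal_measureReal]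
  rw [key, key, abs_le]
  have h1 := integral_sub_integral_le_tv μ ν hm (fun _ => measureReal_nonneg)
    (fun _ => measureReal_le_one)
  have h2 := integral_sub_integral_le_tv ν μ hm (fun _ => measureReal_nonneg)
    (fun _ => measureReal_le_one)
  rw [tv_comm] at h2
  constructor <;> linarith

end TotalVariation

/-! ### Markov property: blocks reduce to their end points -/

section Blocks

variable {Ω : Type*}

lemma comap_past (X : ℤ → Ω → ℝ) (t : ℤ) : MeasurableSpace.comap (past X t) inferInstance =
    ⨆ s : Iic t, MeasurableSpace.comap (X s.1) inferInstance := by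
  simp only [MeasurableSpace.pi, MeasurableSpace.comap_iSup, MeasurableSpace.comap_comp]
  rfl

lemma comap_future (X : ℤ → Ω → ℝ) (t : ℤ) : MeasurableSpace.comap (future X t) inferInstance =
    ⨆ s : Ici t, MeasurableSpace.comap (X s.1) inferInstance := by
  simp only [MeasurableSpace.pi, MeasurableSpace.comap_iSup, MeasurableSpace.comap_comp]
  rfl

lemma comap_past_mono (X : ℤ → Ω → ℝ) : Monotone fun t =>
    MeasurableSpace.comap (past X t) inferInstance := by
  intro s t hst
  simp only [comap_past]
  exact iSup_le fun u => le_iSup (fun u : Iic t => MeasurableSpace.comap (X u.1) inferInstance)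
    ⟨u.1, le_trans u.2 hst⟩

lemma comap_future_anti (X : ℤ → Ω → ℝ) : Antitone fun t =>
    MeasurableSpace.comap (future X t) inferInstance := by
  intro s t hst
  simp only [comap_future]
  exact iSup_le fun u => le_iSup (fun u : Ici s => MeasurableSpace.comap (X u.1) inferInstance)
    ⟨u.1, le_trans hst u.2⟩

lemma measurable_comap_past (X : ℤ → Ω → ℝ) {s t : ℤ} (h : s ≤ t) :
    Measurable[MeasurableSpace.comap (past X t) inferInstance] (X s) := by
  have : X s = (fun f : Iic t → ℝ => f ⟨s, h⟩) ∘ past X t := rfl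
  rw [this]
  exact (measurable_pi_apply _).comp (comap_measurable _)

/-- Testing against a function that is measurable for the conditioning `σ`-algebra. -/
lemma integral_mul_condExp_eq {m m₀ : MeasurableSpace Ω} {P : Measure[m₀] Ω}
    [IsFiniteMeasure P] (hm : m ≤ m₀) {f g : Ω → ℝ}
    (hf : AEStronglyMeasurable[m] f P) (hfg : Integrable (fun ω => f ω * g ω) P)
    (hg : Integrable g P) :
    ∫ ω, f ω * (P[g | m]) ω ∂P = ∫ ω, f ω * g ω ∂P := by
  rw [← integral_condExp hm (f := fun ω => f ω * g ω)]
  exact integral_congr_ae (condExp_mul_of_aestronglyMeasurable_left hf hfg hg).symm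

variable [MeasurableSpace Ω] {P : Measure Ω} {X : ℤ → Ω → ℝ}

lemma measurable_past (hX : ∀ t, Measurable (X t)) (t : ℤ) : Measurable (past X t) :=
  measurable_pi_lambda _ fun s => hX s.1

lemma measurable_future (hX : ∀ t, Measurable (X t)) (t : ℤ) : Measurable (future X t) :=
  measurable_pi_lambda _ fun s => hX s.1

variable [IsProbabilityMeasure P]

/-- Under the Markov property the joint law of a past block and a future block is obtained from
the law of the two end points by drawing the blocks independently. -/
lemma map_past_future_eq_bind (hX : ∀ t, Measurable (X t)) (hM : IsMarkov X P) {s t : ℤ}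
    (hst : s ≤ t) :
    P.map (fun ω => (past X s ω, future X t ω)) =
      (P.map fun ω => (X s ω, X t ω)).bind
        (condDistrib (past X s) (X s) P ∥ₖ condDistrib (future X t) (X t) P) := by
  have hp := measurable_past hX s
  have hf := measurable_future hX t
  have : IsProbabilityMeasure (P.map fun ω => (past X s ω, future X t ω)) :=
    Measure.isProbabilityMeasure_map (hp.prodMk hf).aemeasurable
  refine Measure.ext_prod fun {H B} hH hB => ?_
  set A := past X s ⁻¹' H with hA
  set D := future X t ⁻¹' B with hD
  have mA : MeasurableSet A := hp hH
  have mD : MeasurableSet D := hf hB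
  set k₁ : ℝ → ℝ := fun x => (condDistrib (past X s) (X s) P x).real H
  set k₂ : ℝ → ℝ := fun y => (condDistrib (future X t) (X t) P y).real B
  have mk₁ : Measurable k₁ := (Kernel.measurable_coe _ hH).ennreal_toReal
  have mk₂ : Measurable k₂ := (Kernel.measurable_coe _ hB).ennreal_toReal
  have ck₁ : (fun ω => k₁ (X s ω)) =ᵐ[P] P[A.indicator (fun _ => (1 : ℝ)) |
      MeasurableSpace.comap (X s) inferInstance] :=
    condDistrib_ae_eq_condExp (hX s) hp hH
  have ck₂ : (fun ω => k₂ (X t ω)) =ᵐ[P] P[D.indicator (fun _ => (1 : ℝ)) |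
      MeasurableSpace.comap (X t) inferInstance] :=
    condDistrib_ae_eq_condExp (hX t) hf hB
  have fut : ∀ u ≤ t, MeasurableSet[⨆ s : Ici u, MeasurableSpace.comap (X s.1) inferInstance] D := by
    intro u hu
    rw [← comap_future]
    exact comap_future_anti X hu _ ⟨B, hB, rfl⟩
  have M₁ := hM s D (fut s hst)
  have M₂ := hM t D (fut t le_rfl)
  rw [← comap_past] at M₁ M₂
  have bound : ∀ {f g : Ω → ℝ}, AEStronglyMeasurable f P → AEStronglyMeasurable g P →
      (∀ᵐ ω ∂P, |f ω| ≤ 1) → (∀ᵐ ω ∂P, |g ω| ≤ 1) → Integrable (fun ω => f ω * g ω) P := by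
    intro f g hf hg h1 h2
    refine Integrable.of_bound (hf.mul hg) 1 ?_
    filter_upwards [h1, h2] with ω h1 h2
    rw [Real.norm_eq_abs, abs_mul]
    exact mul_le_one₀ h1 (abs_nonneg _) h2
  have indb : ∀ (E : Set Ω) (ω : Ω), |E.indicator (fun _ => (1 : ℝ)) ω| ≤ 1 := by
    intro E ω
    by_cases h : ω ∈ E <;> simp [h]
  have kb₁ : ∀ x, |k₁ x| ≤ 1 := fun x => by
    rw [abs_of_nonneg measureReal_nonneg]; exact measureReal_le_one
  have iA : Integrable (A.indicator fun _ => (1 : ℝ)) P := (integrable_const _).indicator mA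
  have iD : Integrable (D.indicator fun _ => (1 : ℝ)) P := (integrable_const _).indicator mD
  have le₁ : MeasurableSpace.comap (past X s) inferInstance ≤ ‹MeasurableSpace Ω› :=
    hp.comap_le
  have le₂ : MeasurableSpace.comap (past X t) inferInstance ≤ ‹MeasurableSpace Ω› :=
    (measurable_past hX t).comap_le
  have cD : ∀ᵐ ω ∂P, |P[D.indicator (fun _ => (1 : ℝ)) |
      MeasurableSpace.comap (X s) inferInstance] ω| ≤ 1 := by
    exact ae_bdd_abs_condExp_of_ae_bdd_abs (ae_of_all P (indb D))
  -- Markov at `s` replaces `D` by its conditional probability given `X s`; this in turn lets `A` be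
  -- replaced by `k₁ (X s)`. Then `D` is restored, and Markov at `t` turns it into `k₂ (X t)`, since
  -- `k₁ (X s)` belongs to the past of `t`.
  have key : P.real (A ∩ D) = ∫ ω, k₁ (X s ω) * k₂ (X t ω) ∂P := by
    calc P.real (A ∩ D)
        = ∫ ω, A.indicator (fun _ => (1 : ℝ)) ω * D.indicator (fun _ => (1 : ℝ)) ω ∂P := by
          rw [← integral_indicator_one (mA.inter mD), inter_indicator_one]
          rfl
      _ = ∫ ω, A.indicator (fun _ => (1 : ℝ)) ω * (P[D.indicator (fun _ => (1 : ℝ)) |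
            MeasurableSpace.comap (past X s) inferInstance]) ω ∂P := by
          refine (integral_mul_condExp_eq le₁ ?_ (bound iA.1 iD.1 (ae_of_all _ (indb A))
            (ae_of_all _ (indb D))) iD).symm
          exact ((stronglyMeasurable_const (β := ℝ)).indicator
            ((comap_measurable (past X s)) hH)).aestronglyMeasurable
      _ = ∫ ω, P[D.indicator (fun _ => (1 : ℝ)) | MeasurableSpace.comap (X s) inferInstance] ω *
            A.indicator (fun _ => (1 : ℝ)) ω ∂P :=
          integral_congr_ae (by filter_upwards [M₁] with ω h; rw [h, mul_comm])
      _ = ∫ ω, P[D.indicator (fun _ => (1 : ℝ)) | MeasurableSpace.comap (X s) inferInstance] ω *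
            (P[A.indicator (fun _ => (1 : ℝ)) |
              MeasurableSpace.comap (X s) inferInstance]) ω ∂P := by
          refine (integral_mul_condExp_eq (hX s).comap_le
            stronglyMeasurable_condExp.aestronglyMeasurable ?_ iA).symm
          exact bound integrable_condExp.1 iA.1 cD (ae_of_all _ (indb A))
      _ = ∫ ω, k₁ (X s ω) * (P[D.indicator (fun _ => (1 : ℝ)) |
              MeasurableSpace.comap (X s) inferInstance]) ω ∂P :=
          integral_congr_ae (by filter_upwards [ck₁] with ω h; rw [← h, mul_comm])
      _ = ∫ ω, k₁ (X s ω) * D.indicator (fun _ => (1 : ℝ)) ω ∂P := by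
          refine integral_mul_condExp_eq (hX s).comap_le ?_ ?_ iD
          · exact (mk₁.comp (comap_measurable _)).stronglyMeasurable.aestronglyMeasurable
          · exact bound (mk₁.comp (hX s)).aestronglyMeasurable iD.1
              (ae_of_all _ fun ω => kb₁ _) (ae_of_all _ (indb D))
      _ = ∫ ω, k₁ (X s ω) * (P[D.indicator (fun _ => (1 : ℝ)) |
            MeasurableSpace.comap (past X t) inferInstance]) ω ∂P := by
          refine (integral_mul_condExp_eq le₂ ?_ ?_ iD).symm
          · exact (mk₁.comp (measurable_comap_past X hst)).stronglyMeasurable.aestronglyMeasurable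
          · exact bound (mk₁.comp (hX s)).aestronglyMeasurable iD.1
              (ae_of_all _ fun ω => kb₁ _) (ae_of_all _ (indb D))
      _ = ∫ ω, k₁ (X s ω) * k₂ (X t ω) ∂P :=
          integral_congr_ae (by filter_upwards [M₂, ck₂] with ω h h'; rw [h, h'])
  rw [Measure.map_apply (hp.prodMk hf) (hH.prod hB),
    Measure.bind_apply (hH.prod hB) (Kernel.measurable _).aemeasurable,
    lintegral_map (Kernel.measurable_coe _ (hH.prod hB)) ((hX s).prodMk (hX t))]
  have e : (fun ω => (past X s ω, future X t ω)) ⁻¹' H ×ˢ B = A ∩ D := by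
    ext ω; simp [hA, hD]
  have ik : Integrable (fun ω => k₁ (X s ω) * k₂ (X t ω)) P :=
    bound (mk₁.comp (hX s)).aestronglyMeasurable (mk₂.comp (hX t)).aestronglyMeasurable
      (ae_of_all _ fun ω => kb₁ _)
      (ae_of_all _ fun ω => by
        exact (abs_of_nonneg measureReal_nonneg).trans_le measureReal_le_one)
  rw [e, ← ofReal_measureReal, key,
    ofReal_integral_eq_lintegral_ofReal ik
      (ae_of_all _ fun ω => mul_nonneg measureReal_nonneg measureReal_nonneg)]
  refine lintegral_congr fun ω => ?_
  rw [Kernel.parallelComp_apply_prod, ENNReal.ofReal_mul measureReal_nonneg, ofReal_measureReal,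
    ofReal_measureReal]

/-- Upper bound: both block laws are images of the end-point laws under one kernel. Lower bound: the
end points are coordinates of the blocks. -/
lemma beta_term_eq_betaOne (hX : ∀ t, Measurable (X t)) (hM : IsMarkov X P) (t : ℤ) (b : ℕ) :
    tv ((P.map (past X t)).prod (P.map (future X (t + b))))
      (P.map (fun ω => (past X t ω, future X (t + b) ω))) = betaOne X P t b := by
  have hp := measurable_past hX t
  have hf := measurable_future hX (t + b)
  have i1 : IsProbabilityMeasure (P.map (fun ω => (past X t ω, future X (t + b) ω))) :=
    Measure.isProbabilityMeasure_map (hp.prodMk hf).aemeasurable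
  have i2 : IsProbabilityMeasure (P.map (fun ω => (X t ω, X (t + b) ω))) :=
    Measure.isProbabilityMeasure_map ((hX _).prodMk (hX _)).aemeasurable
  have i3 := Measure.isProbabilityMeasure_map (μ := P) hp.aemeasurable
  have i4 := Measure.isProbabilityMeasure_map (μ := P) hf.aemeasurable
  have i5 := Measure.isProbabilityMeasure_map (μ := P) (hX t).aemeasurable
  have i6 := Measure.isProbabilityMeasure_map (μ := P) (hX (t + b)).aemeasurable
  apply le_antisymm
  · have e : (P.map (past X t)).prod (P.map (future X (t + b))) =
        ((P.map (X t)).prod (P.map (X (t + b)))).bind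
        (condDistrib (past X t) (X t) P ∥ₖ condDistrib (future X (t + b)) (X (t + b)) P) := by
      refine (Measure.ext_prod fun {H B} hH hB => ?_)
      rw [Measure.bind_apply (hH.prod hB) (Kernel.measurable _).aemeasurable]
      simp only [Kernel.parallelComp_apply_prod]
      rw [lintegral_prod_mul (Kernel.measurable_coe _ hH).aemeasurable
        (Kernel.measurable_coe _ hB).aemeasurable,
        ← Measure.bind_apply hH (Kernel.measurable _).aemeasurable,
        ← Measure.bind_apply hB (Kernel.measurable _).aemeasurable,
        condDistrib_comp_map (hX _).aemeasurable hp.aemeasurable,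
        condDistrib_comp_map (hX _).aemeasurable hf.aemeasurable, Measure.prod_prod]
    rw [e, map_past_future_eq_bind hX hM (by lia)]
    exact tv_bind_le _ _ _
  · have m1 : Measurable fun z : Iic t → ℝ => z ⟨t, mem_Iic.2 le_rfl⟩ := measurable_pi_apply _
    have m2 : Measurable fun z : Ici (t + b : ℤ) → ℝ => z ⟨t + b, mem_Ici.2 le_rfl⟩ := measurable_pi_apply _
    have := tv_map_le ((P.map (past X t)).prod (P.map (future X (t + b))))
      (P.map (fun ω => (past X t ω, future X (t + b) ω))) (m1.prodMap m2)
    rw [← Measure.map_prod_map _ _ m1 m2, Measure.map_map m1 hp, Measure.map_map m2 hf,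
      Measure.map_map (m1.prodMap m2) (hp.prodMk hf)] at this
    exact this

end Blocks

/-! ### Consequences of stationarity -/

lemma map_pair_eq {Ω : Type*} [MeasurableSpace Ω] {P : Measure Ω} {X : ℤ → Ω → ℝ}
    (hX : ∀ t, Measurable (X t)) (hS : IsStationary X P) (s t : ℤ) (b : ℕ) :
    P.map (fun ω => (X s ω, X (s + b) ω)) = P.map (fun ω => (X t ω, X (t + b) ω)) := by
  -- Stationarity only shifts forward, so the two orders of `s` and `t` are treated separately
  -- below.
  have key : ∀ (s : ℤ) (j : ℕ), P.map (fun ω => (X s ω, X (s + b) ω)) =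
      P.map (fun ω => (X (s + j) ω, X (s + j + b) ω)) := by
    intro s j
    have h := congrArg (Measure.map fun v : Fin (b + 1) → ℝ => (v 0, v (Fin.last b))) (hS s b j)
    have hm : Measurable fun v : Fin (b + 1) → ℝ => (v 0, v (Fin.last b)) := by fun_prop
    rw [Measure.map_map hm (measurable_pi_lambda _ fun k => hX _),
      Measure.map_map hm (measurable_pi_lambda _ fun k => hX _)] at h
    simpa [Function.comp_def] using h
  rcases le_total s t with h | h
  · obtain ⟨j, hj⟩ := Int.le.dest h
    rw [key s j, hj]
  · obtain ⟨j, hj⟩ := Int.le.dest h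
    rw [key t j, hj]

lemma map_eq_map {Ω : Type*} [MeasurableSpace Ω] {P : Measure Ω} {X : ℤ → Ω → ℝ}
    (hX : ∀ t, Measurable (X t)) (hS : IsStationary X P) (s t : ℤ) :
    P.map (X s) = P.map (X t) := by
  have h := congrArg (Measure.map Prod.fst) (map_pair_eq hX hS s t 0)
  rwa [Measure.map_map measurable_fst ((hX _).prodMk (hX _)),
    Measure.map_map measurable_fst ((hX _).prodMk (hX _))] at h

lemma betaOne_eq {Ω : Type*} [MeasurableSpace Ω] {P : Measure Ω} {X : ℤ → Ω → ℝ}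
    (hX : ∀ t, Measurable (X t)) (hS : IsStationary X P) (s t : ℤ) (b : ℕ) :
    betaOne X P s b = betaOne X P t b := by
  unfold betaOne
  rw [map_pair_eq hX hS s t, map_eq_map hX hS s t, map_eq_map hX hS (s + b) (t + b)]

lemma beta_eq_betaOne {Ω : Type*} [MeasurableSpace Ω] {P : Measure Ω} [IsProbabilityMeasure P]
    {X : ℤ → Ω → ℝ} (hX : ∀ t, Measurable (X t)) (hS : IsStationary X P) (hM : IsMarkov X P)
    (b : ℕ) (t : ℤ) : beta X P b = betaOne X P t b := by
  unfold beta
  simp only [beta_term_eq_betaOne hX hM]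
  simp only [betaOne_eq hX hS _ t, ciSup_const]

/-! ### Conditional probabilities and second moments -/

section SecondMoment

variable {Ω : Type*}

/-- The mean absolute deviation of a conditional probability as a defect of independence. -/
lemma integral_abs_condExp_sub {m m₀ : MeasurableSpace Ω} {P : Measure[m₀] Ω}
    [IsProbabilityMeasure P] (hm : m ≤ m₀) {A : Set Ω} (hA : MeasurableSet[m₀] A) :
    ∫ ω, |(P[A.indicator (fun _ => (1 : ℝ)) | m]) ω - P.real A| ∂P =
      2 * (P.real ({ω | P.real A ≤ (P[A.indicator (fun _ => (1 : ℝ)) | m]) ω} ∩ A) -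
        P.real {ω | P.real A ≤ (P[A.indicator (fun _ => (1 : ℝ)) | m]) ω} * P.real A) := by
  set c := P.real A
  set u := P[A.indicator (fun _ => (1 : ℝ)) | m]
  set G := {ω | c ≤ u ω}
  have hu : StronglyMeasurable[m] u := stronglyMeasurable_condExp
  have hG : MeasurableSet[m] G := measurableSet_le (α := ℝ) measurable_const hu.measurable
  have iA : Integrable (A.indicator fun _ => (1 : ℝ)) P := (integrable_const _).indicator hA
  have iu : Integrable u P := integrable_condExp
  have huc : Integrable (fun ω => u ω - c) P := iu.sub (integrable_const _)
  have e0 : ∫ ω, (u ω - c) ∂P = 0 := by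
    rw [integral_sub iu (integrable_const _), integral_condExp hm]
    simp [integral_indicator hA, c]
  -- `|x| = 2x⁺ - x`, and `u - c` has mean zero, so only its integral over `G` survives.
  have e1 : ∀ ω, |u ω - c| = 2 * G.indicator (fun ω => u ω - c) ω - (u ω - c) := by
    intro ω
    by_cases h : ω ∈ G
    · have h' : c ≤ u ω := h
      rw [indicator_of_mem h, abs_of_nonneg (by linarith)]; ring
    · have h' : u ω < c := not_le.1 h
      rw [indicator_of_notMem h, abs_of_neg (by linarith)]; ring
  simp only [e1]
  rw [integral_sub ((huc.indicator (hm _ hG)).const_mul 2) huc, e0, sub_zero, integral_const_mul,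
    integral_indicator (hm _ hG), integral_sub iu.integrableOn (integrable_const _),
    setIntegral_condExp hm iA hG, setIntegral_indicator hA]
  simp [c]

variable [MeasurableSpace Ω] {P : Measure Ω} [IsProbabilityMeasure P]

lemma integral_abs_le_sqrt {S : Ω → ℝ} (h1 : Integrable S P)
    (h2 : Integrable (fun ω => S ω ^ 2) P) : ∫ ω, |S ω| ∂P ≤ √(∫ ω, S ω ^ 2 ∂P) := by
  refine Real.le_sqrt_of_sq_le ?_
  set c := ∫ ω, |S ω| ∂P with hc
  -- The variance of `|S|` is nonnegative.
  have h0 : 0 ≤ ∫ ω, (S ω ^ 2 - 2 * c * |S ω| + c ^ 2) ∂P := by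
    refine integral_nonneg fun ω => ?_
    have : S ω ^ 2 - 2 * c * |S ω| + c ^ 2 = (|S ω| - c) ^ 2 := by
      rw [← sq_abs (S ω)]; ring
    simp only [Pi.zero_apply, this]
    positivity
  have h3 : Integrable (fun ω => 2 * c * |S ω|) P := h1.abs.const_mul _
  have h4 : Integrable (fun ω => S ω ^ 2 - 2 * c * |S ω|) P := h2.sub h3
  rw [integral_add h4 (integrable_const _),
    integral_sub h2 h3, integral_const_mul, ← hc] at h0
  simp only [integral_const, probReal_univ, one_smul] at h0
  nlinarith

/-- An `L¹` bound for sums of bounded variables that are uncorrelated at distance at least `d`. -/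
lemma integral_abs_sum_le_sqrt (n d : ℕ) (q : ℝ) {D : ℕ → Ω → ℝ}
    (hD : ∀ i, AEStronglyMeasurable (D i) P) (hb : ∀ i, ∀ᵐ ω ∂P, |D i ω| ≤ 1)
    (hq : ∀ i, ∫ ω, |D i ω| ∂P ≤ q)
    (h0 : ∀ i l, i + d ≤ l → ∫ ω, D i ω * D l ω ∂P = 0) :
    ∫ ω, |∑ i ∈ Finset.Icc 1 n, D i ω| ∂P ≤ √(n * (2 * d) * q) := by
  have hint : ∀ i, Integrable (D i) P := fun i =>
    Integrable.of_bound (hD i) 1 (by simpa using hb i)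
  have hint2 : ∀ i l, Integrable (fun ω => D i ω * D l ω) P := by
    intro i l
    refine Integrable.of_bound ((hD i).mul (hD l)) 1 ?_
    filter_upwards [hb i, hb l] with ω h1 h2
    rw [Real.norm_eq_abs, abs_mul]
    exact mul_le_one₀ h1 (abs_nonneg _) h2
  have hq0 : 0 ≤ q := (integral_nonneg fun ω => abs_nonneg (D 0 ω)).trans (hq 0)
  -- Bounding only one factor by `1` keeps `q` in the estimate. With `q` proportional to a cell
  -- probability, the bounds stay summable over cells.
  have hle : ∀ i l, ∫ ω, D i ω * D l ω ∂P ≤ q := by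
    intro i l
    refine le_trans (integral_mono_ae (hint2 i l) (hint i).abs ?_) (hq i)
    filter_upwards [hb l] with ω h
    calc D i ω * D l ω ≤ |D i ω * D l ω| := le_abs_self _
      _ = |D i ω| * |D l ω| := abs_mul _ _
      _ ≤ |D i ω| := mul_le_of_le_one_right (abs_nonneg _) h
  have hsq : ∀ ω, (∑ i ∈ Finset.Icc 1 n, D i ω) ^ 2 =
      ∑ i ∈ Finset.Icc 1 n, ∑ l ∈ Finset.Icc 1 n, D i ω * D l ω := fun ω => by
    rw [sq, Finset.sum_mul_sum]
  have hint3 : ∀ i, Integrable (fun ω => ∑ l ∈ Finset.Icc 1 n, D i ω * D l ω) P := fun i =>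
    integrable_finsetSum _ fun l _ => hint2 i l
  refine (integral_abs_le_sqrt (integrable_finsetSum _ fun i _ => hint i) ?_).trans
    (Real.sqrt_le_sqrt ?_)
  · simp only [hsq]
    exact integrable_finsetSum _ fun i _ => hint3 i
  · simp only [hsq]
    rw [integral_finsetSum _ fun i _ => hint3 i]
    have hrow : ∀ i, ∫ ω, ∑ l ∈ Finset.Icc 1 n, D i ω * D l ω ∂P ≤ 2 * d * q := by
      intro i
      rw [integral_finsetSum _ fun l _ => hint2 i l]
      -- Only indices closer than `d` to `i` contribute, at most `2d` of them; truncated subtraction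
      -- can only shorten the interval used to count them.
      have hcard : (((Finset.Icc 1 n).filter fun l => i < l + d ∧ l < i + d).card : ℝ) ≤
          2 * d := by
        have : ((Finset.Icc 1 n).filter fun l => i < l + d ∧ l < i + d).card ≤
            (Finset.Ico (i + 1 - d) (i + d)).card := by
          refine Finset.card_le_card fun l hl => ?_
          simp only [Finset.mem_filter, Finset.mem_Icc, Finset.mem_Ico] at hl ⊢
          lia
        have h2 : (Finset.Ico (i + 1 - d) (i + d)).card ≤ 2 * d := by
          rw [Nat.card_Ico]; lia
        exact_mod_cast this.trans h2
      calc ∑ l ∈ Finset.Icc 1 n, ∫ ω, D i ω * D l ω ∂P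
          ≤ ∑ l ∈ Finset.Icc 1 n, if i < l + d ∧ l < i + d then q else 0 := by
            refine Finset.sum_le_sum fun l _ => ?_
            split_ifs with h
            · exact hle i l
            · rw [not_and_or, not_lt, not_lt] at h
              rcases h with h | h
              · refine le_of_eq ?_
                rw [← h0 l i h]
                simp only [mul_comm]
              · exact (h0 i l h).le
        _ = ((Finset.Icc 1 n).filter fun l => i < l + d ∧ l < i + d).card * q := by
            rw [← Finset.sum_filter, Finset.sum_const, nsmul_eq_mul]
        _ ≤ 2 * d * q := mul_le_mul_of_nonneg_right hcard hq0
    refine (Finset.sum_le_sum fun i _ => hrow i).trans (le_of_eq ?_)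
    rw [Finset.sum_const, Nat.card_Icc, nsmul_eq_mul]
    simp only [Nat.add_sub_cancel]
    ring

end SecondMoment

/-! ### Empirical frequency of one event -/

section Frequency

variable {Ω : Type*}

/-- Mean deviation of the empirical frequency of events `A i` of equal probability `q`, in terms of
the conditional probabilities of the `A i` given `σ`-algebras `F i` that contain the events that
occur at least `d` steps earlier. -/
lemma integral_abs_freq_sub_le {m₀ : MeasurableSpace Ω} {P : Measure[m₀] Ω}
    [IsProbabilityMeasure P] {F : ℕ → MeasurableSpace Ω} (hF : ∀ i, F i ≤ m₀) {A : ℕ → Set Ω}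
    (hA : ∀ i, MeasurableSet[m₀] (A i)) {q : ℝ} (hq : ∀ i, P.real (A i) = q) {d : ℕ}
    (hFmono : ∀ i l, i + d ≤ l → F i ≤ F l)
    (hAF : ∀ i l, i + d ≤ l → MeasurableSet[F l] (A i)) {n : ℕ} (hn : 0 < n) :
    ∫ ω, |(n : ℝ)⁻¹ * (∑ i ∈ Finset.Icc 1 n, (A i).indicator (fun _ => (1 : ℝ)) ω) - q| ∂P ≤
      (n : ℝ)⁻¹ * √(n * (2 * d) * (2 * q)) +
        (n : ℝ)⁻¹ * ∑ i ∈ Finset.Icc 1 n,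
          ∫ ω, |(P[(A i).indicator (fun _ => (1 : ℝ)) | F i]) ω - q| ∂P := by
  have iξ : ∀ i, Integrable ((A i).indicator fun _ => (1 : ℝ)) P := fun i =>
    (integrable_const _).indicator (hA i)
  have hξ0 : ∀ i ω, 0 ≤ (A i).indicator (fun _ => (1 : ℝ)) ω := fun i ω =>
    indicator_nonneg (fun _ _ => zero_le_one) ω
  have hξ1 : ∀ i ω, (A i).indicator (fun _ => (1 : ℝ)) ω ≤ 1 := fun i ω =>
    indicator_le_self' (fun _ _ => zero_le_one) ω
  have hξq : ∀ i, ∫ ω, (A i).indicator (fun _ => (1 : ℝ)) ω ∂P = q := fun i => by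
    simp [integral_indicator (hA i), hq]
  have hξF : ∀ i l, i + d ≤ l → StronglyMeasurable[F l] ((A i).indicator fun _ => (1 : ℝ)) :=
    fun i l h => (stronglyMeasurable_const (β := ℝ)).indicator (hAF i l h)
  generalize hξdef : (fun i => (A i).indicator fun _ => (1 : ℝ)) = ξ at *
  have hξdef' : ∀ i, (A i).indicator (fun _ => (1 : ℝ)) = ξ i := fun i => congrFun hξdef i
  simp only [hξdef'] at *
  have iC : ∀ i, Integrable (P[ξ i | F i]) P := fun i => integrable_condExp
  have hC0 : ∀ i, ∀ᵐ ω ∂P, 0 ≤ (P[ξ i | F i]) ω := fun i =>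
    condExp_nonneg (ae_of_all _ fun ω => hξ0 i ω)
  have hC1 : ∀ i, ∀ᵐ ω ∂P, (P[ξ i | F i]) ω ≤ 1 := fun i => by
    have := condExp_mono (m := F i) (iξ i) (integrable_const (1 : ℝ))
      (ae_of_all P fun ω => hξ1 i ω)
    rw [condExp_const (hF i)] at this
    exact this
  have hCq : ∀ i, ∫ ω, (P[ξ i | F i]) ω ∂P = q := fun i =>
    (integral_condExp (hF i)).trans (hξq i)
  have hCF : ∀ i l, i + d ≤ l → StronglyMeasurable[F l] (P[ξ i | F i]) := fun i l h =>
    stronglyMeasurable_condExp.mono (hFmono i l h)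
  have hCi : ∀ i (g : Ω → ℝ), AEStronglyMeasurable[F i] g P →
      Integrable (fun ω => g ω * ξ i ω) P →
      ∫ ω, g ω * (P[ξ i | F i]) ω ∂P = ∫ ω, g ω * ξ i ω ∂P := fun i g hg hgi =>
    integral_mul_condExp_eq (hF i) hg hgi (iξ i)
  generalize hCdef : (fun i => P[ξ i | F i]) = C at *
  have hCdef' : ∀ i, P[ξ i | F i] = C i := fun i => congrFun hCdef i
  simp only [hCdef'] at *
  have iD : ∀ i, Integrable (fun ω => ξ i ω - C i ω) P := fun i => (iξ i).sub (iC i)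
  have hDb : ∀ i, ∀ᵐ ω ∂P, |ξ i ω - C i ω| ≤ 1 := fun i => by
    filter_upwards [hC0 i, hC1 i] with ω h0 h1
    have := hξ0 i ω
    have := hξ1 i ω
    rw [abs_le]
    constructor <;> linarith
  -- Both terms are nonnegative with mean `q`.
  have hDq : ∀ i, ∫ ω, |ξ i ω - C i ω| ∂P ≤ 2 * q := fun i => by
    calc ∫ ω, |ξ i ω - C i ω| ∂P ≤ ∫ ω, (ξ i ω + C i ω) ∂P := by
          refine integral_mono_ae (iD i).abs ((iξ i).add (iC i)) ?_
          filter_upwards [hC0 i] with ω h0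
          have := hξ0 i ω
          rw [abs_le]
          constructor <;> linarith
      _ = 2 * q := by rw [integral_add (iξ i) (iC i), hξq, hCq]; ring
  -- The earlier remainder is `F l`-measurable, and the later one is orthogonal to all bounded such
  -- variables.
  have hDo : ∀ i l, i + d ≤ l → ∫ ω, (ξ i ω - C i ω) * (ξ l ω - C l ω) ∂P = 0 := by
    intro i l hil
    have hm : AEStronglyMeasurable[F l] (fun ω => ξ i ω - C i ω) P :=
      ((hξF i l hil).sub (hCF i l hil)).aestronglyMeasurable
    have hi : ∀ {g : Ω → ℝ}, Integrable g P → (∀ᵐ ω ∂P, |g ω| ≤ 1) →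
        Integrable (fun ω => (ξ i ω - C i ω) * g ω) P := by
      intro g hg hg1
      refine Integrable.of_bound ((iD i).1.mul hg.1) 1 ?_
      filter_upwards [hDb i, hg1] with ω h1 h2
      rw [Real.norm_eq_abs, abs_mul]
      exact mul_le_one₀ h1 (abs_nonneg _) h2
    have i1 := hi (iξ l) (ae_of_all _ fun ω => by
      rw [abs_of_nonneg (hξ0 l ω)]; exact hξ1 l ω)
    have i2 := hi (iC l) (by
      filter_upwards [hC0 l, hC1 l] with ω h0 h1
      rwa [abs_of_nonneg h0])
    simp only [mul_sub (ξ i _ - C i _)]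
    rw [integral_sub i1 i2, sub_eq_zero]
    exact (hCi l _ hm i1).symm
  have hn' : (0 : ℝ) < n := Nat.cast_pos.2 hn
  have iS : Integrable (fun ω => ∑ i ∈ Finset.Icc 1 n, (ξ i ω - C i ω)) P :=
    integrable_finsetSum _ fun i _ => iD i
  have iCp : ∀ i, Integrable (fun ω => |C i ω - q|) P := fun i =>
    ((iC i).sub (integrable_const _)).abs
  have iT : Integrable (fun ω => ∑ i ∈ Finset.Icc 1 n, |C i ω - q|) P :=
    integrable_finsetSum _ fun i _ => iCp i
  have iE : Integrable (fun ω => |(n : ℝ)⁻¹ * (∑ i ∈ Finset.Icc 1 n, ξ i ω) - q|) P :=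
    (((integrable_finsetSum _ fun i _ => iξ i).const_mul _).sub (integrable_const _)).abs
  calc ∫ ω, |(n : ℝ)⁻¹ * (∑ i ∈ Finset.Icc 1 n, ξ i ω) - q| ∂P
      ≤ ∫ ω, ((n : ℝ)⁻¹ * |∑ i ∈ Finset.Icc 1 n, (ξ i ω - C i ω)| +
          (n : ℝ)⁻¹ * ∑ i ∈ Finset.Icc 1 n, |C i ω - q|) ∂P := by
        refine integral_mono iE ((iS.abs.const_mul _).add (iT.const_mul _)) fun ω => ?_
        have e : (n : ℝ)⁻¹ * (∑ i ∈ Finset.Icc 1 n, ξ i ω) - q =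
            (n : ℝ)⁻¹ * (∑ i ∈ Finset.Icc 1 n, (ξ i ω - C i ω) +
              ∑ i ∈ Finset.Icc 1 n, (C i ω - q)) := by
          rw [← Finset.sum_add_distrib]
          simp only [sub_add_sub_cancel]
          rw [Finset.sum_sub_distrib, Finset.sum_const, Nat.card_Icc, nsmul_eq_mul]
          simp only [Nat.add_sub_cancel]
          field_simp
        simp only [e]
        rw [abs_mul, abs_of_pos (inv_pos.2 hn'), ← mul_add]
        refine mul_le_mul_of_nonneg_left ((abs_add_le _ _).trans ?_) (inv_pos.2 hn').le
        gcongr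
        exact Finset.abs_sum_le_sum_abs _ _
    _ = (n : ℝ)⁻¹ * ∫ ω, |∑ i ∈ Finset.Icc 1 n, (ξ i ω - C i ω)| ∂P +
          (n : ℝ)⁻¹ * ∑ i ∈ Finset.Icc 1 n, ∫ ω, |C i ω - q| ∂P := by
        rw [integral_add (iS.abs.const_mul _) (iT.const_mul _), integral_const_mul,
          integral_const_mul, integral_finsetSum _ fun i _ => iCp i]
    _ ≤ _ := by
        gcongr
        exact integral_abs_sum_le_sqrt n d (2 * q) (D := fun i ω => ξ i ω - C i ω)
          (fun i => (iD i).1) hDb hDq hDo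

end Frequency

/-! ### Frequencies of many cells under mixing -/

section Mixing

variable {Ω : Type*} [MeasurableSpace Ω] {P : Measure Ω} [IsProbabilityMeasure P]
  {X : ℤ → Ω → ℝ} {ι : Type*} [MeasurableSpace ι] [MeasurableSingletonClass ι]

lemma beta_term_le_beta (hX : ∀ t, Measurable (X t)) (t : ℤ) (m : ℕ) :
    tv ((P.map (past X t)).prod (P.map (future X (t + m))))
      (P.map (fun ω => (past X t ω, future X (t + m) ω))) ≤ beta X P m := by
  -- The bound `1` makes the real supremum genuine; an unbounded family would have the default value
  -- `0`.
  refine le_ciSup (f := fun t : ℤ => tv ((P.map (past X t)).prod (P.map (future X (t + m))))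
      (P.map (fun ω => (past X t ω, future X (t + m) ω)))) ⟨1, ?_⟩ t
  rintro _ ⟨t, rfl⟩
  have hp := measurable_past hX t
  have hf := measurable_future hX (t + m)
  have i1 : IsProbabilityMeasure (P.map (fun ω => (past X t ω, future X (t + m) ω))) :=
    Measure.isProbabilityMeasure_map (hp.prodMk hf).aemeasurable
  have i3 := Measure.isProbabilityMeasure_map (μ := P) hp.aemeasurable
  have i4 := Measure.isProbabilityMeasure_map (μ := P) hf.aemeasurable
  exact tv_le_one _ _

/-- The conditional law, given the past, of a discrete function of the future is close to its
unconditional law in mean total variation. -/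
lemma sum_integral_abs_condExp_sub_le (hX : ∀ t, Measurable (X t)) {t u : ℤ} {m : ℕ}
    (hu : u = t + m) {φ : (Ici u → ℝ) → ι} (hφ : Measurable φ) (S : Finset ι) :
    ∑ j ∈ S, ∫ ω, |(P[((φ ∘ future X u) ⁻¹' {j}).indicator (fun _ => (1 : ℝ)) |
        MeasurableSpace.comap (past X t) inferInstance]) ω -
          P.real ((φ ∘ future X u) ⁻¹' {j})| ∂P ≤ 2 * beta X P m := by
  subst hu
  have hp := measurable_past hX t
  have hf := measurable_future hX (t + m)
  have i1 : IsProbabilityMeasure (P.map (fun ω => (past X t ω, future X (t + m) ω))) :=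
    Measure.isProbabilityMeasure_map (hp.prodMk hf).aemeasurable
  have i3 := Measure.isProbabilityMeasure_map (μ := P) hp.aemeasurable
  have i4 := Measure.isProbabilityMeasure_map (μ := P) hf.aemeasurable
  have hA : ∀ j, MeasurableSet ((φ ∘ future X (t + m)) ⁻¹' {j}) := fun j =>
    (hφ.comp hf) (measurableSet_singleton j)
  have hG : ∀ j, ∃ H : Set (Iic t → ℝ), MeasurableSet H ∧ past X t ⁻¹' H =
      {ω | P.real ((φ ∘ future X (t + m)) ⁻¹' {j}) ≤
        (P[((φ ∘ future X (t + m)) ⁻¹' {j}).indicator (fun _ => (1 : ℝ)) |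
        MeasurableSpace.comap (past X t) inferInstance]) ω} := by
    intro j
    have : MeasurableSet[MeasurableSpace.comap (past X t) inferInstance]
        {ω | P.real ((φ ∘ future X (t + m)) ⁻¹' {j}) ≤
          (P[((φ ∘ future X (t + m)) ⁻¹' {j}).indicator (fun _ => (1 : ℝ)) |
            MeasurableSpace.comap (past X t) inferInstance]) ω} :=
      measurableSet_le (α := ℝ) measurable_const stronglyMeasurable_condExp.measurable
    exact this
  choose H hH hHe using hG
  simp only [integral_abs_condExp_sub hp.comap_le (hA _), ← hHe]
  -- For each `j`, `H j` is the past event on which the conditional probability is at least its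
  -- mean. Since `φ` takes one value, the rectangles are disjoint, and all the defects add up to the
  -- discrepancy of the single event `C`; hence one `β(m)` covers every cell.
  set C : Set ((Iic t → ℝ) × (Ici (t + m : ℤ) → ℝ)) := ⋃ j ∈ S, H j ×ˢ (φ ⁻¹' {j}) with hC
  have mr : ∀ j, MeasurableSet (H j ×ˢ (φ ⁻¹' {j})) := fun j =>
    (hH j).prod (hφ (measurableSet_singleton j))
  have mC : MeasurableSet C := Finset.measurableSet_biUnion _ fun j _ => mr j
  have dis : PairwiseDisjoint (S : Set ι) fun j => H j ×ˢ (φ ⁻¹' {j}) := by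
    intro i _ j _ hij
    refine disjoint_left.2 fun z hz hz' => hij ?_
    exact (mem_singleton_iff.1 hz.2).symm.trans (mem_singleton_iff.1 hz'.2)
  have h := (neg_le_abs _).trans ((abs_real_sub_real_le_tv _ _ mC).trans
    (beta_term_le_beta (P := P) hX t m))
  rw [hC, measureReal_biUnion_finset dis fun j _ => mr j,
    measureReal_biUnion_finset dis fun j _ => mr j, ← Finset.sum_sub_distrib,
    ← Finset.sum_neg_distrib] at h
  rw [← Finset.mul_sum]
  refine mul_le_mul_of_nonneg_left (le_trans (Finset.sum_le_sum fun j _ => ?_) h) zero_le_two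
  rw [measureReal_prod_prod, map_measureReal_apply (hp.prodMk hf) (mr j),
    map_measureReal_apply hp (hH j), map_measureReal_apply hf (hφ (measurableSet_singleton j)),
    neg_sub]
  rfl

/-- Mean `L¹` error, over finitely many cells, of the empirical frequencies of a stationary
sequence of discrete functions of windows of length `a` of a mixing process. -/
lemma integral_sum_abs_freq_sub_le [DecidableEq ι] (hX : ∀ t, Measurable (X t)) (a : ℕ)
    {Z : ℤ → Ω → ι}
    (hZf : ∀ i : ℤ, ∃ φ : (Ici i → ℝ) → ι, Measurable φ ∧ Z i = φ ∘ future X i)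
    (hZp : ∀ i : ℤ, Measurable[MeasurableSpace.comap (past X (i + a)) inferInstance] (Z i))
    {p : ι → ℝ} (hp : ∀ i j, P.real (Z i ⁻¹' {j}) = p j) (S : Finset ι) (m : ℕ) {n : ℕ}
    (hn : 0 < n) :
    ∫ ω, ∑ j ∈ S, |(n : ℝ)⁻¹ * (∑ i ∈ Finset.Icc 1 n, if Z (i : ℤ) ω = j then (1 : ℝ) else 0)
        - p j| ∂P ≤ √(4 * (m + a) * S.card / n) + 2 * beta X P m := by
  have hZm : ∀ i, Measurable (Z i) := fun i => by
    obtain ⟨φ, hφ, h⟩ := hZf i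
    rw [h]
    exact hφ.comp (measurable_future hX i)
  have hA : ∀ i j, MeasurableSet (Z i ⁻¹' {j}) := fun i j => hZm i (measurableSet_singleton j)
  have hp0 : ∀ j, 0 ≤ p j := fun j => by rw [← hp 0 j]; exact measureReal_nonneg
  have hps : ∑ j ∈ S, p j ≤ 1 := by
    simp only [← hp 0]
    rw [← measureReal_biUnion_finset _ fun j _ => hA 0 j]
    · exact measureReal_le_one
    · intro i _ j _ hij
      exact disjoint_left.2 fun z hz hz' => hij (hz.symm.trans hz')
  have hn' : (0 : ℝ) < n := Nat.cast_pos.2 hn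
  have hj : ∀ j, ∫ ω, |(n : ℝ)⁻¹ * (∑ i ∈ Finset.Icc 1 n,
      (Z (i : ℕ) ⁻¹' {j}).indicator (fun _ => (1 : ℝ)) ω) - p j| ∂P ≤
      (n : ℝ)⁻¹ * √(n * (2 * (m + a : ℕ)) * (2 * p j)) +
        (n : ℝ)⁻¹ * ∑ i ∈ Finset.Icc 1 n,
          ∫ ω, |(P[(Z (i : ℕ) ⁻¹' {j}).indicator (fun _ => (1 : ℝ)) |
            MeasurableSpace.comap (past X ((i : ℕ) - m)) inferInstance]) ω - p j| ∂P := by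
    intro j
    -- The distance is `m + a` because `Z i` looks ahead to time `i + a`, which must precede the
    -- conditioning time `l - m`.
    refine integral_abs_freq_sub_le (A := fun i : ℕ => Z i ⁻¹' {j})
      (F := fun i : ℕ => MeasurableSpace.comap (past X (i - m)) inferInstance)
      (fun i => (measurable_past hX _).comap_le) (fun i => hA i j) (fun i => hp i j)
      (d := m + a) (fun i l h => ?_) (fun i l h => ?_) hn
    · exact comap_past_mono X (by lia)
    · exact comap_past_mono X (by lia : (i : ℤ) + a ≤ l - m) _
        (hZp i (measurableSet_singleton j))
  have hmix : ∀ i : ℤ, ∑ j ∈ S, ∫ ω, |(P[(Z i ⁻¹' {j}).indicator (fun _ => (1 : ℝ)) |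
      MeasurableSpace.comap (past X (i - m)) inferInstance]) ω - p j| ∂P ≤ 2 * beta X P m := by
    intro i
    obtain ⟨φ, hφ, h⟩ := hZf i
    have := sum_integral_abs_condExp_sub_le (P := P) hX (t := i - m) (u := i) (m := m) (by ring)
      hφ S
    rw [← h] at this
    simpa only [hp] using this
  -- Cauchy–Schwarz over the cells, whose probabilities sum to at most `1`.
  have hcs : ∑ j ∈ S, √(n * (2 * (m + a : ℕ)) * (2 * p j)) ≤ √(4 * (m + a) * S.card * n) := by
    refine Real.le_sqrt_of_sq_le (sq_sum_le_card_mul_sum_sq.trans ?_)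
    have e : ∀ j, √((n : ℝ) * (2 * (m + a : ℕ)) * (2 * p j)) ^ 2 = 4 * (m + a) * n * p j :=
      fun j => by
        rw [Real.sq_sqrt (by have := hp0 j; positivity)]; push_cast; ring
    simp only [e]
    rw [← Finset.mul_sum]
    calc (S.card : ℝ) * (4 * (m + a) * n * ∑ j ∈ S, p j)
        ≤ S.card * (4 * (m + a) * n * 1) := by gcongr
      _ = _ := by ring
  have iE : ∀ j, Integrable (fun ω => |(n : ℝ)⁻¹ * (∑ i ∈ Finset.Icc 1 n,
      (Z (i : ℕ) ⁻¹' {j}).indicator (fun _ => (1 : ℝ)) ω) - p j|) P := fun j =>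
    (((integrable_finsetSum _ fun (i : ℕ) _ => (integrable_const (1 : ℝ)).indicator
      (hA i j)).const_mul _).sub (integrable_const _)).abs
  have hξ : ∀ j (i : ℤ) ω, (Z i ⁻¹' {j}).indicator (fun _ => (1 : ℝ)) ω =
      if Z i ω = j then (1 : ℝ) else 0 := fun j i ω => by
    by_cases h : Z i ω = j <;> simp [h]
  simp only [← hξ]
  rw [integral_finsetSum _ fun j _ => iE j]
  refine (Finset.sum_le_sum fun j _ => hj j).trans ?_
  rw [Finset.sum_add_distrib, ← Finset.mul_sum, ← Finset.mul_sum, Finset.sum_comm]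
  refine add_le_add ?_ ?_
  · refine (mul_le_mul_of_nonneg_left hcs (inv_pos.2 hn').le).trans (le_of_eq ?_)
    rw [show (4 * (m + a) * S.card / n : ℝ) = 4 * (m + a) * S.card * n / n ^ 2 by
      field_simp, Real.sqrt_div' _ (by positivity), Real.sqrt_sq hn'.le]
    ring
  · refine (mul_le_mul_of_nonneg_left (Finset.sum_le_sum fun (i : ℕ) _ => hmix i)
      (inv_pos.2 hn').le).trans (le_of_eq ?_)
    rw [Finset.sum_const, Nat.card_Icc, nsmul_eq_mul]
    simp only [Nat.add_sub_cancel]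
    field_simp

end Mixing

/-! ### `ℓ¹` distances of discrete laws -/

section DiscreteL1

variable {ι : Type*}

/-- Off `S`, `|q - p| ≤ (q - p) + 2p`; on `S`, `|q - p| ≤ (q - p) + 2|q - p|`. As `q - p` sums to
zero, the tail of the empirical `q` needs no separate control. -/
lemma tsum_abs_sub_le {q p : ι → ℝ} (hq0 : ∀ j, 0 ≤ q j) (hp0 : ∀ j, 0 ≤ p j)
    (hq : HasSum q 1) (hp : HasSum p 1) (S : Finset ι) :
    ∑' j, |q j - p j| ≤ 2 * ∑ j ∈ S, |q j - p j| + 2 * (1 - ∑ j ∈ S, p j) := by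
  classical
  have hS : ∀ g : ι → ℝ, HasSum (fun j => if j ∈ S then g j else 0) (∑ j ∈ S, g j) := fun g => by
    have : HasSum (fun j => if j ∈ S then g j else 0) (∑ j ∈ S, if j ∈ S then g j else 0) :=
      hasSum_sum_of_ne_finset_zero fun j hj => by simp [hj]
    rwa [Finset.sum_congr rfl fun j hj => if_pos hj] at this
  have h := ((hq.sub hp).add ((hS fun j => |q j - p j|).mul_left 2)).add
    ((hp.sub (hS p)).mul_left 2)
  have e : (1 : ℝ) - 1 + 2 * ∑ j ∈ S, |q j - p j| + 2 * (1 - ∑ j ∈ S, p j) =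
    2 * ∑ j ∈ S, |q j - p j| + 2 * (1 - ∑ j ∈ S, p j) := by ring
  rw [e] at h
  refine hasSum_le (fun j => ?_) (hq.summable.sub hp.summable).abs.hasSum h
  have h1 := hq0 j
  have h2 := hp0 j
  by_cases hj : j ∈ S
  · simp only [hj, if_true, sub_self, mul_zero, add_zero]
    linarith [neg_abs_le (q j - p j)]
  · simp only [hj, if_false, sub_zero, mul_zero, add_zero]
    rw [abs_le]; constructor <;> linarith

/-- The `L¹` distance of a joint distribution from the product of given margins is stable. -/
lemma abs_half_tsum_sub_le {q₂ p₂ : ι × ι → ℝ} {q p : ι → ℝ} (hq0 : ∀ j, 0 ≤ q j)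
    (hp0 : ∀ j, 0 ≤ p j) (hq : HasSum q 1) (hp : HasSum p 1) (hq₂ : Summable q₂)
    (hp₂ : Summable p₂) :
    |(1 / 2 * ∑' j, |q₂ j - q j.1 * q j.2|) - (1 / 2 * ∑' j, |p₂ j - p j.1 * p j.2|)| ≤
      (1 / 2 * ∑' j, |q₂ j - p₂ j|) + ∑' k, |q k - p k| := by
  have prod : ∀ {f g : ι → ℝ} {s t : ℝ}, (∀ j, 0 ≤ f j) → (∀ j, 0 ≤ g j) → HasSum f s →
      HasSum g t → HasSum (fun j : ι × ι => f j.1 * g j.2) (s * t) := by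
    intro f g s t hf0 hg0 hf hg
    exact hf.mul hg (hf.summable.mul_of_nonneg hg.summable hf0 hg0)
  have hd := (hq.summable.sub hp.summable).abs.hasSum
  have hd0 : ∀ j, 0 ≤ |q j - p j| := fun j => abs_nonneg _
  have s1 := (hq₂.sub (prod hq0 hq0 hq hq).summable).abs
  have s2 := (hp₂.sub (prod hp0 hp0 hp hp).summable).abs
  have h := ((hq₂.sub hp₂).abs.hasSum.add (prod hq0 hd0 hq hd)).add (prod hd0 hp0 hd hp)
  have key := tsum_of_norm_bounded
    (f := fun j : ι × ι => |q₂ j - q j.1 * q j.2| - |p₂ j - p j.1 * p j.2|) h fun j => ?_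
  · rw [s1.tsum_sub s2, Real.norm_eq_abs] at key
    rw [← mul_sub, abs_mul, abs_of_nonneg (by norm_num : (0 : ℝ) ≤ 1 / 2)]
    linarith
  · rw [Real.norm_eq_abs]
    refine (abs_abs_sub_abs_le_abs_sub _ _).trans ?_
    have e : q₂ j - q j.1 * q j.2 - (p₂ j - p j.1 * p j.2) =
      (q₂ j - p₂ j) - q j.1 * (q j.2 - p j.2) - (q j.1 - p j.1) * p j.2 := by ring
    rw [e]
    refine (abs_sub _ _).trans (add_le_add ((abs_sub _ _).trans (add_le_add le_rfl ?_)) ?_)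
    · rw [abs_mul, abs_of_nonneg (hq0 _)]
    · rw [abs_mul, abs_of_nonneg (hp0 _)]

end DiscreteL1

/-! ### Total variation on countable partitions -/

section Partition

variable {E ι : Type*} [MeasurableSpace E] [MeasurableSpace ι] [Countable ι]
  [MeasurableSingletonClass ι]

lemma hasSum_indicator_real_preimage (μ : Measure E) [IsFiniteMeasure μ] {f : E → ι}
    (hf : Measurable f) (J : Set ι) :
    HasSum (J.indicator fun j => μ.real (f ⁻¹' {j})) (μ.real (f ⁻¹' J)) := by
  have hJ : MeasurableSet J := J.to_countable.measurableSet
  have h := Measure.tsum_indicator_apply_singleton (μ.map f) J hJ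
  have h2 := ENNReal.hasSum_toReal (h.trans_ne (measure_ne_top _ _))
  rw [← ENNReal.tsum_toReal_eq fun j => ENNReal.ne_top_of_tsum_ne_top
    (h.trans_ne (measure_ne_top _ _)) j, h, Measure.map_apply hf hJ] at h2
  have e : (J.indicator fun j => μ.real (f ⁻¹' {j})) =
      fun j => (J.indicator (fun j => μ.map f {j}) j).toReal := by
    ext j
    by_cases hj : j ∈ J
    · rw [indicator_of_mem hj, indicator_of_mem hj,
        Measure.map_apply hf (measurableSet_singleton j)]
      rfl
    · rw [indicator_of_notMem hj, indicator_of_notMem hj]; rfl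
  rwa [e]

lemma hasSum_real_preimage (μ : Measure E) [IsProbabilityMeasure μ] {f : E → ι}
    (hf : Measurable f) : HasSum (fun j => μ.real (f ⁻¹' {j})) 1 := by
  have := hasSum_indicator_real_preimage μ hf univ
  simpa using this

/-- Half the `ℓ¹` distance is attained by the union `J` of the cells where `μ` dominates, because
the cell differences sum to zero. -/
lemma half_tsum_abs_le_tv (μ ν : Measure E) [IsProbabilityMeasure μ] [IsProbabilityMeasure ν]
    {f : E → ι} (hf : Measurable f) :
    1 / 2 * ∑' j, |μ.real (f ⁻¹' {j}) - ν.real (f ⁻¹' {j})| ≤ tv μ ν := by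
  set J : Set ι := {j | ν.real (f ⁻¹' {j}) ≤ μ.real (f ⁻¹' {j})}
  have h1 := (hasSum_indicator_real_preimage μ hf J).sub (hasSum_indicator_real_preimage ν hf J)
  have h2 := (hasSum_real_preimage μ hf).sub (hasSum_real_preimage ν hf)
  have h3 := (h1.mul_left 2).sub h2
  have e : ∀ j, 2 * (J.indicator (fun j => μ.real (f ⁻¹' {j})) j -
      J.indicator (fun j => ν.real (f ⁻¹' {j})) j) - (μ.real (f ⁻¹' {j}) - ν.real (f ⁻¹' {j})) =
      |μ.real (f ⁻¹' {j}) - ν.real (f ⁻¹' {j})| := by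
    intro j
    by_cases hj : j ∈ J
    · have : ν.real (f ⁻¹' {j}) ≤ μ.real (f ⁻¹' {j}) := hj
      rw [indicator_of_mem hj, indicator_of_mem hj, abs_of_nonneg (sub_nonneg.2 this)]; ring
    · have : μ.real (f ⁻¹' {j}) < ν.real (f ⁻¹' {j}) := not_le.1 hj
      rw [indicator_of_notMem hj, indicator_of_notMem hj, abs_of_neg (sub_neg.2 this)]; ring
  simp only [e] at h3
  rw [h3.tsum_eq]
  have := (le_abs_self _).trans
    (abs_real_sub_real_le_tv μ ν (hf J.to_countable.measurableSet))
  linarith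

/-- Twice the difference on `J` equals the sum of the cell differences with sign `+` on `J` and `-`
off it, again because their total is zero. -/
lemma abs_real_preimage_sub_le (μ ν : Measure E) [IsProbabilityMeasure μ]
    [IsProbabilityMeasure ν] {f : E → ι} (hf : Measurable f) (J : Set ι) :
    |μ.real (f ⁻¹' J) - ν.real (f ⁻¹' J)| ≤
      1 / 2 * ∑' j, |μ.real (f ⁻¹' {j}) - ν.real (f ⁻¹' {j})| := by
  have h1 := (hasSum_indicator_real_preimage μ hf J).sub (hasSum_indicator_real_preimage ν hf J)
  have h2 := (hasSum_real_preimage μ hf).sub (hasSum_real_preimage ν hf)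
  have h3 := (h1.mul_left 2).sub h2
  have key := tsum_of_norm_bounded h2.summable.abs.hasSum (f := fun j =>
    2 * (J.indicator (fun j => μ.real (f ⁻¹' {j})) j -
      J.indicator (fun j => ν.real (f ⁻¹' {j})) j) - (μ.real (f ⁻¹' {j}) - ν.real (f ⁻¹' {j})))
    fun j => ?_
  · rw [h3.tsum_eq, sub_self, sub_zero, Real.norm_eq_abs, abs_mul, abs_two] at key
    linarith
  · rw [Real.norm_eq_abs]
    by_cases hj : j ∈ J
    · rw [indicator_of_mem hj, indicator_of_mem hj]
      exact le_of_eq (congrArg abs (by ring))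
    · rw [indicator_of_notMem hj, indicator_of_notMem hj, abs_sub_comm]
      simp

/-- The total variation distances on finer and finer partitions converge to the total variation
distance. -/
lemma tendsto_half_tsum_abs {E : Type*} [MetricSpace E] [MeasurableSpace E] [BorelSpace E]
    [ProperSpace E] (μ ν : Measure E) [IsProbabilityMeasure μ] [IsProbabilityMeasure ν] {κ : Type*} {l : Filter κ}
    {f : κ → E → ι} (hf : ∀ k, Measurable (f k))
    (hfine : ∀ δ > 0, ∀ᶠ k in l, ∀ z w, f k z = f k w → dist z w ≤ δ) :
    Tendsto (fun k => 1 / 2 * ∑' j, |μ.real (f k ⁻¹' {j}) - ν.real (f k ⁻¹' {j})|) l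
      (𝓝 (tv μ ν)) := by
  rw [Metric.tendsto_nhds]
  intro ε hε
  have hε3 : 0 < ε / 3 := by positivity
  have : Nonempty {C : Set E // MeasurableSet C} := ⟨⟨∅, MeasurableSet.empty⟩⟩
  obtain ⟨⟨C, hC⟩, hC2⟩ := exists_lt_of_lt_ciSup (show tv μ ν - ε / 3 < ⨆ C : {C : Set E //
    MeasurableSet C}, |μ.real C.1 - ν.real C.1| from sub_lt_self _ hε3)
  -- Approximating in the sum controls both measures at once.
  set ρ : Measure E := μ + ν
  obtain ⟨K, hKC, hK, hρ⟩ := hC.exists_isCompact_sdiff_lt (μ := ρ) (measure_ne_top _ _)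
    (ENNReal.ofReal_pos.2 hε3).ne'
  have hT := tendsto_measure_cthickening_of_isCompact (μ := ρ) hK
  have hT2 : ∀ᶠ r in 𝓝 (0 : ℝ), ρ.real (Metric.cthickening r K) < ρ.real K + ε / 3 := by
    have := (ENNReal.tendsto_toReal (measure_ne_top ρ K)).comp hT
    exact this.eventually (gt_mem_nhds (lt_add_of_pos_right _ hε3))
  obtain ⟨δ, hδ, hδ2⟩ := Metric.eventually_nhds_iff.1 hT2
  have hδ3 := hδ2 (y := δ / 2) (by
    rw [Real.dist_eq, sub_zero, abs_of_pos (by positivity)]; linarith)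
  filter_upwards [hfine (δ / 2) (by positivity)] with k hk
  -- The union of the cells that meet `K`: for a fine partition it lies in a thin thickening of `K`,
  -- so `C` and `U` both contain `K` with `ρ`-excess below `ε / 3`.
  set U := f k ⁻¹' (f k '' K)
  have hU : MeasurableSet U := hf k (to_countable _).measurableSet
  have hKU : K ⊆ U := subset_preimage_image _ _
  have hUT : U ⊆ Metric.cthickening (δ / 2) K := by
    rintro z ⟨w, hw, hwz⟩
    exact Metric.mem_cthickening_of_dist_le z w _ _ hw (hk _ _ hwz.symm)
  have hρ' : ρ.real C < ρ.real K + ε / 3 := by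
    have h1 : ρ.real (C \ K) < ε / 3 := by
      rw [measureReal_def]
      exact ENNReal.toReal_lt_of_lt_ofReal hρ
    have h2 := measureReal_sdiff_add_inter (μ := ρ) (s := C) hK.measurableSet
    rw [inter_eq_self_of_subset_right hKC] at h2
    linarith
  have hρr : ∀ B, ρ.real B = μ.real B + ν.real B := fun B => measureReal_add_apply
  rw [hρr, hρr] at hρ' hδ3
  have m1 := measureReal_mono (μ := μ) hKC
  have m2 := measureReal_mono (μ := ν) hKC
  have m3 := measureReal_mono (μ := μ) hKU
  have m4 := measureReal_mono (μ := ν) hKU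
  have m5 := measureReal_mono (μ := μ) hUT
  have m6 := measureReal_mono (μ := ν) hUT
  have m7 := measureReal_mono (μ := μ) (hKU.trans hUT)
  have m8 := measureReal_mono (μ := ν) (hKU.trans hUT)
  have h1 := half_tsum_abs_le_tv μ ν (hf k)
  have h2 := abs_real_preimage_sub_le μ ν (hf k) (f k '' K)
  have h3 : |μ.real C - ν.real C| ≤ |μ.real U - ν.real U| + 2 * (ε / 3) := by
    have := abs_le.1 (le_refl |μ.real U - ν.real U|)
    rw [abs_le]
    constructor <;> linarith
  rw [Real.dist_eq, abs_lt]
  simp only at hC2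
  constructor <;> linarith

lemma integral_comp_eq_tsum (μ : Measure E) {f : E → ι} (hf : Measurable f) {v : ℝ}
    (hv : 0 ≤ v) (hfv : ∀ j, μ (f ⁻¹' {j}) = ENNReal.ofReal v) {F : ι → ℝ} (hF : ∀ j, 0 ≤ F j) :
    ∫ z, F (f z) ∂μ = ∑' j, F j * v := by
  have hFm : Measurable F := measurable_of_countable F
  rw [integral_eq_lintegral_of_nonneg_ae (ae_of_all _ fun z => hF _)
    (hFm.comp hf).aestronglyMeasurable,
    ← lintegral_map (f := fun j => ENNReal.ofReal (F j)) hFm.ennreal_ofReal hf,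
    lintegral_countable', ENNReal.tsum_toReal_eq]
  · refine tsum_congr fun j => ?_
    rw [Measure.map_apply hf (measurableSet_singleton j), hfv, ← ENNReal.ofReal_mul (hF j),
      ENNReal.toReal_ofReal (mul_nonneg (hF j) hv)]
  · intro j
    rw [Measure.map_apply hf (measurableSet_singleton j), hfv]
    exact ENNReal.mul_ne_top ENNReal.ofReal_ne_top ENNReal.ofReal_ne_top

end Partition

/-! ### Grid cells and the estimator as a sum -/

section Histogram

variable {Ω : Type*} {ι : Type*} [DecidableEq ι]

/-- Empirical frequencies of `Z 1, …, Z n`. -/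
noncomputable def freq (Z : ℤ → Ω → ι) (n : ℕ) (ω : Ω) (j : ι) : ℝ :=
  (n : ℝ)⁻¹ * ∑ i ∈ Finset.Icc 1 n, if Z (i : ℤ) ω = j then (1 : ℝ) else 0

lemma freq_nonneg (Z : ℤ → Ω → ι) (n : ℕ) (ω : Ω) (j : ι) : 0 ≤ freq Z n ω j := by
  refine mul_nonneg (by positivity) (Finset.sum_nonneg fun i _ => ?_)
  split_ifs <;> norm_num

lemma hasSum_freq (Z : ℤ → Ω → ι) {n : ℕ} (hn : 0 < n) (ω : Ω) : HasSum (freq Z n ω) 1 := by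
  have h : ∀ i ∈ Finset.Icc 1 n, HasSum (fun j => if Z (i : ℤ) ω = j then (1 : ℝ) else 0) 1 :=
    fun i _ => by simpa only [eq_comm] using hasSum_ite_eq (Z (i : ℤ) ω) (1 : ℝ)
  have := (hasSum_sum h).mul_left (n : ℝ)⁻¹
  rw [Finset.sum_const, Nat.card_Icc, Nat.add_sub_cancel, nsmul_eq_mul, mul_one,
    inv_mul_cancel₀ (Nat.cast_ne_zero.2 hn.ne')] at this
  exact this

/-- Index of the square cell that contains a point of the plane. -/
noncomputable def cell (c h : ℝ) (z : ℝ × ℝ) : ℤ × ℤ := (bin c h z.1, bin c h z.2)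

lemma measurable_bin (c h : ℝ) : Measurable (bin c h) :=
  Int.measurable_floor.comp ((measurable_id.sub_const c).div_const h)

lemma measurable_cell (c h : ℝ) : Measurable (cell c h) :=
  ((measurable_bin c h).comp measurable_fst).prodMk ((measurable_bin c h).comp measurable_snd)

lemma bin_mono (c : ℝ) {h : ℝ} (hh : 0 < h) : Monotone (bin c h) := fun _ _ hxy =>
  Int.floor_mono (div_le_div_of_nonneg_right (sub_le_sub_right hxy c) hh.le)

lemma bin_preimage (c : ℝ) {h : ℝ} (hh : 0 < h) (k : ℤ) :
    bin c h ⁻¹' {k} = Ico (c + k * h) (c + k * h + h) := by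
  ext x
  simp only [bin, mem_preimage, mem_singleton_iff, Int.floor_eq_iff, mem_Ico, le_div_iff₀ hh,
    div_lt_iff₀ hh]
  constructor <;> rintro ⟨h1, h2⟩ <;> constructor <;> linarith

lemma cell_preimage (c h : ℝ) (j : ℤ × ℤ) :
    cell c h ⁻¹' {j} = (bin c h ⁻¹' {j.1}) ×ˢ (bin c h ⁻¹' {j.2}) := by
  ext z
  simp [cell, Prod.ext_iff]

lemma volume_cell (c : ℝ) {h : ℝ} (hh : 0 < h) (j : ℤ × ℤ) :
    volume (cell c h ⁻¹' {j}) = ENNReal.ofReal (h ^ 2) := by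
  rw [cell_preimage, Measure.volume_eq_prod, Measure.prod_prod, bin_preimage c hh,
    bin_preimage c hh, Real.volume_Ico, Real.volume_Ico, ← ENNReal.ofReal_mul (by linarith)]
  congr 1
  ring

lemma dist_le_of_bin_eq {c h : ℝ} (hh : 0 < h) {x y : ℝ} (hxy : bin c h x = bin c h y) :
    dist x y ≤ h := by
  have h1 : x ∈ bin c h ⁻¹' {bin c h y} := hxy
  have h2 : y ∈ bin c h ⁻¹' {bin c h y} := rfl
  rw [bin_preimage c hh] at h1 h2
  rw [Real.dist_eq, abs_le]
  constructor <;> linarith [h1.1, h1.2, h2.1, h2.2]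

lemma dist_le_of_cell_eq {c h : ℝ} (hh : 0 < h) {z w : ℝ × ℝ} (hzw : cell c h z = cell c h w) :
    dist z w ≤ h := by
  rw [cell, cell, Prod.mk.injEq] at hzw
  rw [Prod.dist_eq]
  exact max_le (dist_le_of_bin_eq hh hzw.1) (dist_le_of_bin_eq hh hzw.2)

lemma card_Icc_bin_le (c : ℝ) {h R : ℝ} (hh : 0 < h) (hR : 0 ≤ R) :
    ((Finset.Icc (bin c h (-R)) (bin c h R)).card : ℝ) ≤ 2 * R / h + 2 := by
  have hm := bin_mono c hh (show -R ≤ R by linarith)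
  rw [Int.card_Icc, ← Int.cast_natCast, Int.toNat_of_nonneg (by lia)]
  have h1 := Int.floor_le ((R - c) / h)
  have h2 := Int.lt_floor_add_one ((-R - c) / h)
  have e : (R - c) / h - (-R - c) / h = 2 * R / h := by ring
  push_cast
  simp only [bin]
  linarith

lemma betaHat_eq_tsum (X : ℤ → Ω → ℝ) (c : ℝ) {h : ℝ} (hh : 0 < h) (a n : ℕ) (ω : Ω) :
    betaHat X c h a n ω = 1 / 2 * ∑' j : ℤ × ℤ,
      |freq (fun i ω => cell c h (X i ω, X (i + a) ω)) (n - a) ω j -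
        freq (fun i ω => bin c h (X i ω)) n ω j.1 * freq (fun i ω => bin c h (X i ω)) n ω j.2| := by
  -- The integrand depends on `z` only through its cell; its factor `h⁻²` later cancels the cell
  -- area.
  have e : ∀ z : ℝ × ℝ, |histTwo X c h a n ω z - histOne X c h n ω z.1 * histOne X c h n ω z.2| =
      (fun j : ℤ × ℤ => |freq (fun i ω => cell c h (X i ω, X (i + a) ω)) (n - a) ω j -
        freq (fun i ω => bin c h (X i ω)) n ω j.1 *
          freq (fun i ω => bin c h (X i ω)) n ω j.2| * (h ^ 2)⁻¹) (cell c h z) := by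
    intro z
    have h0 : 0 ≤ (h ^ 2)⁻¹ := by positivity
    simp only
    refine Eq.trans (congrArg abs ?_) ((abs_mul _ _).trans (congrArg _ (abs_of_nonneg h0)))
    have e₂ : histTwo X c h a n ω z = (h ^ 2)⁻¹ *
        freq (fun i ω => cell c h (X i ω, X (i + a) ω)) (n - a) ω (cell c h z) := by
      simp only [histTwo, freq, mul_inv]
      rw [mul_comm (((n - a : ℕ) : ℝ)⁻¹), mul_assoc]
      congr 2
      exact Finset.sum_congr rfl fun i _ => if_congr (by simp [cell]) rfl rfl
    have e₁ : ∀ x, histOne X c h n ω x =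
        h⁻¹ * freq (fun i ω => bin c h (X i ω)) n ω (bin c h x) := fun x => by
      simp only [histOne, freq, mul_inv]
      ring
    rw [e₂, e₁, e₁]
    simp only [cell]
    ring
  unfold betaHat
  simp only [e]
  rw [integral_comp_eq_tsum volume (measurable_cell c h) (sq_nonneg h) (volume_cell c hh)
    (F := fun j : ℤ × ℤ => |freq (fun i ω => cell c h (X i ω, X (i + a) ω)) (n - a) ω j -
        freq (fun i ω => bin c h (X i ω)) n ω j.1 *
          freq (fun i ω => bin c h (X i ω)) n ω j.2| * (h ^ 2)⁻¹) fun j => by positivity]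
  congr 1
  refine tsum_congr fun j => ?_
  field_simp

end Histogram

/-! ### Deviation bound and consistency -/

section Consistency

variable {Ω : Type*} [MeasurableSpace Ω] {P : Measure Ω} [IsProbabilityMeasure P]
  {X : ℤ → Ω → ℝ}

/-- Half the `L¹` distance between the cell probabilities of the joint law of `X 0` and `X a`
and those of the product of its margins. -/
noncomputable def gridBeta (X : ℤ → Ω → ℝ) (P : Measure Ω) (c h : ℝ) (a : ℕ) : ℝ :=
  1 / 2 * ∑' j : ℤ × ℤ, |(P.map fun ω => (X 0 ω, X (0 + a) ω)).real (cell c h ⁻¹' {j}) -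
    (P.map (X 0)).real (bin c h ⁻¹' {j.1}) * (P.map (X 0)).real (bin c h ⁻¹' {j.2})|

lemma tendsto_gridBeta (hX : ∀ t, Measurable (X t)) (hS : IsStationary X P) (a : ℕ) {κ : Type*}
    {l : Filter κ} {c h : κ → ℝ} (hpos : ∀ k, 0 < h k) (hlim : Tendsto h l (𝓝 0)) :
    Tendsto (fun k => gridBeta X P (c k) (h k) a) l (𝓝 (betaOne X P 0 a)) := by
  have i1 : IsProbabilityMeasure (P.map (fun ω => (X 0 ω, X (0 + a) ω))) :=
    Measure.isProbabilityMeasure_map ((hX _).prodMk (hX _)).aemeasurable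
  have i2 := Measure.isProbabilityMeasure_map (μ := P) (hX 0).aemeasurable
  have h1 := tendsto_half_tsum_abs ((P.map (X 0)).prod (P.map (X 0)))
    (P.map fun ω => (X 0 ω, X (0 + a) ω)) (l := l) (f := fun k => cell (c k) (h k))
    (fun k => measurable_cell _ _) (fun δ hδ => by
      filter_upwards [hlim.eventually (ge_mem_nhds hδ)] with k hk z w hzw
      exact (dist_le_of_cell_eq (hpos k) hzw).trans hk)
  have e : betaOne X P 0 a = tv ((P.map (X 0)).prod (P.map (X 0)))
      (P.map fun ω => (X 0 ω, X (0 + a) ω)) := by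
    rw [betaOne, map_eq_map hX hS (0 + a) 0]
  rw [e]
  refine h1.congr fun k => ?_
  unfold gridBeta
  congr 1
  refine tsum_congr fun j => ?_
  rw [abs_sub_comm]
  congr 2
  rw [cell_preimage, measureReal_prod_prod]

lemma integrable_sum_abs_freq_sub {ι : Type*} [DecidableEq ι] [MeasurableSpace ι]
    [MeasurableSingletonClass ι] {Z : ℤ → Ω → ι} (hZ : ∀ i, Measurable (Z i)) (n : ℕ)
    (p : ι → ℝ) (S : Finset ι) : Integrable (fun ω => ∑ j ∈ S, |freq Z n ω j - p j|) P := by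
  refine integrable_finsetSum _ fun j _ => Integrable.abs (Integrable.sub ?_ (integrable_const _))
  refine Integrable.const_mul (integrable_finsetSum _ fun i _ => ?_) _
  have : (fun ω => if Z (i : ℤ) ω = j then (1 : ℝ) else 0) =
      (Z (i : ℤ) ⁻¹' {j}).indicator fun _ => 1 := by
    ext ω
    by_cases h : Z (i : ℤ) ω = j <;> simp [h]
  rw [this]
  exact (integrable_const _).indicator (hZ _ (measurableSet_singleton j))

/-- Deviation bound for the estimator from its population version on the same grid. -/
lemma real_le_abs_betaHat_sub_le (hX : ∀ t, Measurable (X t)) (hS : IsStationary X P) (a : ℕ)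
    (c : ℝ) {h : ℝ} (hh : 0 < h) {n : ℕ} (hn : a < n) {R : ℝ} (hR : 0 ≤ R) (m : ℕ) {ε : ℝ}
    (hε : 0 < ε) :
    P.real {ω | ε ≤ |betaHat X c h a n ω - gridBeta X P c h a|} ≤
      (3 * √(4 * (m + a) * (2 * R / h + 2) ^ 2 / (n - a : ℕ)) + 6 * beta X P m +
        4 * (P.map (X 0)).real (Icc (-R) R)ᶜ) / ε := by
  have i1 : IsProbabilityMeasure (P.map (fun ω => (X 0 ω, X (0 + a) ω))) :=
    Measure.isProbabilityMeasure_map ((hX _).prodMk (hX _)).aemeasurable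
  have i2 := Measure.isProbabilityMeasure_map (μ := P) (hX 0).aemeasurable
  set p₁ : ℤ → ℝ := fun k => (P.map (X 0)).real (bin c h ⁻¹' {k})
  set p₂ : ℤ × ℤ → ℝ := fun j =>
    (P.map fun ω => (X 0 ω, X (0 + a) ω)).real (cell c h ⁻¹' {j})
  set Z₁ : ℤ → Ω → ℤ := fun i ω => bin c h (X i ω)
  set Z₂ : ℤ → Ω → ℤ × ℤ := fun i ω => cell c h (X i ω, X (i + a) ω)
  set τ := (P.map (X 0)).real (Icc (-R) R)ᶜ
  set Q := 4 * (m + a) * (2 * R / h + 2) ^ 2 / ((n - a : ℕ) : ℝ)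
  set S := Finset.Icc (bin c h (-R)) (bin c h R)
  have hna : 0 < n - a := by lia
  have hn0 : 0 < n := by lia
  have hp₁ : HasSum p₁ 1 := hasSum_real_preimage _ (measurable_bin c h)
  have hp₂ : HasSum p₂ 1 := hasSum_real_preimage _ (measurable_cell c h)
  have hmem : ∀ x ∈ Icc (-R) R, bin c h x ∈ S := fun x hx =>
    Finset.mem_Icc.2 ⟨bin_mono c hh hx.1, bin_mono c hh hx.2⟩
  have t₁ : 1 - ∑ k ∈ S, p₁ k ≤ τ := by
    rw [sum_measureReal_preimage_singleton S
      fun k _ => measurable_bin c h (measurableSet_singleton k),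
      ← probReal_compl_eq_one_sub (measurable_bin c h S.measurableSet)]
    exact measureReal_mono (compl_subset_compl.2 fun x hx => hmem x hx)
  have t₂ : 1 - ∑ j ∈ S ×ˢ S, p₂ j ≤ 2 * τ := by
    rw [sum_measureReal_preimage_singleton (S ×ˢ S)
      fun j _ => measurable_cell c h (measurableSet_singleton j),
      ← probReal_compl_eq_one_sub (measurable_cell c h (S ×ˢ S).measurableSet)]
    have hsub : (cell c h ⁻¹' ((S ×ˢ S : Finset (ℤ × ℤ)) : Set (ℤ × ℤ)))ᶜ ⊆
        (Prod.fst ⁻¹' (Icc (-R) R)ᶜ) ∪ (Prod.snd ⁻¹' (Icc (-R) R)ᶜ) := by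
      intro z hz
      by_contra hcon
      simp only [mem_union, mem_preimage, mem_compl_iff, not_or, not_not] at hcon
      exact hz (Finset.mem_coe.2 (Finset.mem_product.2 ⟨hmem _ hcon.1, hmem _ hcon.2⟩))
    refine (measureReal_mono hsub).trans ((measureReal_union_le _ _).trans (le_of_eq ?_))
    have hI : MeasurableSet (Icc (-R) R)ᶜ := measurableSet_Icc.compl
    rw [map_measureReal_apply ((hX _).prodMk (hX _)) (measurable_fst hI),
      map_measureReal_apply ((hX _).prodMk (hX _)) (measurable_snd hI), two_mul]
    congr 1
    · exact (map_measureReal_apply (hX 0) hI).symm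
    · simp only [τ]
      rw [← map_eq_map hX hS (0 + a) 0, map_measureReal_apply (hX _) hI]
      rfl
  have law₁ : ∀ i k, P.real (Z₁ i ⁻¹' {k}) = p₁ k := fun i k => by
    simp only [p₁]
    rw [← map_eq_map hX hS i 0,
      map_measureReal_apply (hX _) (measurable_bin c h (measurableSet_singleton k))]
    rfl
  have law₂ : ∀ i j, P.real (Z₂ i ⁻¹' {j}) = p₂ j := fun i j => by
    simp only [p₂]
    rw [← map_pair_eq hX hS i 0, map_measureReal_apply ((hX _).prodMk (hX _))
      (measurable_cell c h (measurableSet_singleton j))]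
    rfl
  have fut₁ : ∀ i : ℤ, ∃ φ : (Ici i → ℝ) → ℤ, Measurable φ ∧ Z₁ i = φ ∘ future X i := fun i =>
    ⟨fun f => bin c h (f ⟨i, mem_Ici.2 le_rfl⟩),
      (measurable_bin c h).comp (measurable_pi_apply _), rfl⟩
  have fut₂ : ∀ i : ℤ, ∃ φ : (Ici i → ℝ) → ℤ × ℤ, Measurable φ ∧ Z₂ i = φ ∘ future X i :=
    fun i => ⟨fun f => cell c h (f ⟨i, mem_Ici.2 le_rfl⟩, f ⟨i + a, mem_Ici.2 (by lia)⟩),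
      (measurable_cell c h).comp ((measurable_pi_apply _).prodMk (measurable_pi_apply _)), rfl⟩
  -- A single observation is treated as a window of length `a`, so one bound serves both histograms.
  have pst₁ : ∀ i : ℤ, Measurable[MeasurableSpace.comap (past X (i + a)) inferInstance] (Z₁ i) :=
    fun i => (measurable_bin c h).comp (measurable_comap_past X (by lia))
  have pst₂ : ∀ i : ℤ, Measurable[MeasurableSpace.comap (past X (i + a)) inferInstance] (Z₂ i) :=
    fun i => (measurable_cell c h).comp
      ((measurable_comap_past X (by lia)).prodMk (measurable_comap_past X le_rfl))
  have hcard := card_Icc_bin_le c hh hR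
  have hcard1 : (1 : ℝ) ≤ S.card := by
    have : 0 < S.card := Finset.card_pos.2
      ⟨_, Finset.left_mem_Icc.2 (bin_mono c hh (show -R ≤ R by linarith))⟩
    exact_mod_cast this
  have hcard2 : (S.card : ℝ) ^ 2 ≤ (2 * R / h + 2) ^ 2 := by gcongr
  -- The one-dimensional error is weakened to the planar `Q`, using `1 ≤ S.card` and `n - a ≤ n`.
  have e₁ : ∫ ω, ∑ k ∈ S, |freq Z₁ n ω k - p₁ k| ∂P ≤ √Q + 2 * beta X P m := by
    refine (integral_sum_abs_freq_sub_le hX a fut₁ pst₁ law₁ S m hn0).trans ?_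
    gcongr
    simp only [Q]
    have : ((n - a : ℕ) : ℝ) ≤ n := by exact_mod_cast Nat.sub_le n a
    have : (0 : ℝ) < (n - a : ℕ) := by exact_mod_cast hna
    gcongr
    nlinarith
  have e₂ : ∫ ω, ∑ j ∈ S ×ˢ S, |freq Z₂ (n - a) ω j - p₂ j| ∂P ≤ √Q + 2 * beta X P m := by
    refine (integral_sum_abs_freq_sub_le hX a fut₂ pst₂ law₂ (S ×ˢ S) m hna).trans ?_
    gcongr
    simp only [Q]
    gcongr
    rw [Finset.card_product]
    push_cast
    nlinarith
  have j₁ : Integrable (fun ω => ∑ k ∈ S, |freq Z₁ n ω k - p₁ k|) P :=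
    integrable_sum_abs_freq_sub (fun i => (measurable_bin c h).comp (hX i)) n p₁ S
  have j₂ : Integrable (fun ω => ∑ j ∈ S ×ˢ S, |freq Z₂ (n - a) ω j - p₂ j|) P :=
    integrable_sum_abs_freq_sub
      (fun i => (measurable_cell c h).comp ((hX i).prodMk (hX _))) (n - a) p₂ (S ×ˢ S)
  -- The pair error enters with weight `1/2`, the margin error with weight `1`. Truncation to `S`
  -- doubles each sum, and the tails give `2τ` from the pairs and `2τ` from the margin.
  set W : Ω → ℝ := fun ω => ∑ j ∈ S ×ˢ S, |freq Z₂ (n - a) ω j - p₂ j| +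
    2 * ∑ k ∈ S, |freq Z₁ n ω k - p₁ k| + 4 * τ
  have jW : Integrable W P := (j₂.add (j₁.const_mul 2)).add (integrable_const _)
  have eW : ∫ ω, W ω ∂P ≤ 3 * √Q + 6 * beta X P m + 4 * τ := by
    have j₃ : Integrable (fun ω => ∑ j ∈ S ×ˢ S, |freq Z₂ (n - a) ω j - p₂ j| +
      2 * ∑ k ∈ S, |freq Z₁ n ω k - p₁ k|) P := j₂.add (j₁.const_mul 2)
    simp only [W]
    rw [integral_add j₃ (integrable_const _), integral_add j₂ (j₁.const_mul 2),
      integral_const_mul]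
    simp only [integral_const, probReal_univ, one_smul]
    linarith
  have hτ : 0 ≤ τ := measureReal_nonneg
  have W0 : ∀ ω, 0 ≤ W ω := fun ω => by positivity
  have hW : ∀ ω, |betaHat X c h a n ω - gridBeta X P c h a| ≤ W ω := by
    intro ω
    rw [betaHat_eq_tsum X c hh]
    refine (abs_half_tsum_sub_le (freq_nonneg Z₁ n ω) (fun k => measureReal_nonneg)
      (hasSum_freq Z₁ hn0 ω) hp₁ (hasSum_freq Z₂ hna ω).summable hp₂.summable).trans ?_
    have b₁ := tsum_abs_sub_le (freq_nonneg Z₁ n ω) (fun k => measureReal_nonneg)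
      (hasSum_freq Z₁ hn0 ω) hp₁ S
    have b₂ := tsum_abs_sub_le (freq_nonneg Z₂ (n - a) ω) (fun k => measureReal_nonneg)
      (hasSum_freq Z₂ hna ω) hp₂ (S ×ˢ S)
    simp only [W]
    linarith
  rw [le_div_iff₀ hε, mul_comm]
  refine le_trans ?_ eW
  -- Markov's inequality for `W`; the event for `betaHat` is merely included in that for `W`, so its
  -- measurability plays no role.
  refine le_trans ?_ (mul_meas_ge_le_integral_of_nonneg (ae_of_all _ W0) jW ε)
  refine mul_le_mul_of_nonneg_left (measureReal_mono fun ω hω => ?_) hε.le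
  exact le_trans hω (hW ω)

/-- Consistency of the estimator along any sequence of sample sizes for which the expected number
of observations per cell of a bounded region tends to infinity. -/
lemma tendstoInMeasure_betaHat (hX : ∀ t, Measurable (X t)) (hS : IsStationary X P)
    (hβ : Tendsto (fun m : ℕ => beta X P m) atTop (𝓝 0)) (a : ℕ) {N : ℕ → ℕ} {c h : ℕ → ℝ}
    (hpos : ∀ k, 0 < h k) (hlim : Tendsto h atTop (𝓝 0))
    (hN : Tendsto (fun k => (N k : ℝ) * h k ^ 2) atTop atTop) :
    TendstoInMeasure P (fun k ω => betaHat X (c k) (h k) a (N k) ω) atTop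
      (fun _ => betaOne X P 0 a) := by
  have i2 := Measure.isProbabilityMeasure_map (μ := P) (hX 0).aemeasurable
  rw [tendstoInMeasure_iff_measureReal_norm]
  intro ε hε
  rw [Metric.tendsto_nhds]
  intro η hη
  -- The target after Markov's inequality at level `ε / 2`. The constants `24`, `16` and `4` below
  -- make each of the three terms less than `θ / 4`; `m` and `R` are fixed before `k`.
  set θ := η * (ε / 2)
  have hθ : 0 < θ := by positivity
  obtain ⟨m, hm⟩ := (hβ.eventually (gt_mem_nhds (show 0 < θ / 24 by positivity))).exists
  obtain ⟨R, hR, hτ⟩ : ∃ R : ℝ, 0 ≤ R ∧ (P.map (X 0)).real (Icc (-R) R)ᶜ < θ / 16 := by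
    obtain ⟨K, -, hK, hKτ⟩ := MeasurableSet.univ.exists_isCompact_sdiff_lt (μ := P.map (X 0))
      (measure_ne_top _ _) (ENNReal.ofReal_pos.2 (show 0 < θ / 16 by positivity)).ne'
    obtain ⟨R, hR, hKR⟩ := hK.isBounded.subset_closedBall_lt 0 0
    rw [Real.closedBall_eq_Icc, zero_sub, zero_add] at hKR
    refine ⟨R, hR.le, (measureReal_mono (compl_subset_compl.2 hKR)).trans_lt ?_⟩
    rw [compl_eq_univ_sdiff, measureReal_def]
    exact ENNReal.toReal_lt_of_lt_ofReal hKτ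
  have hden : Tendsto (fun k => (N k : ℝ) * h k ^ 2 + -(a * h k ^ 2)) atTop atTop := by
    refine hN.atTop_add (C := 0) ?_
    simpa using ((hlim.pow 2).const_mul (a : ℝ)).neg
  have hlarge : ∀ᶠ k in atTop, a < N k := by
    filter_upwards [hden.eventually_gt_atTop 0] with k hk
    have h1 : (a : ℝ) * h k ^ 2 < N k * h k ^ 2 := by linarith
    exact_mod_cast lt_of_mul_lt_mul_right h1 (sq_nonneg _)
  -- Multiplying numerator and denominator by `h²` leaves a bounded numerator over `(N - a) h² → ∞`.
  have hQ : Tendsto (fun k => 3 * √(4 * (m + a) * (2 * R / h k + 2) ^ 2 / (N k - a : ℕ))) atTop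
      (𝓝 0) := by
    have hnum : Tendsto (fun k => 4 * (m + a) * (2 * R + 2 * h k) ^ 2) atTop
        (𝓝 (4 * (m + a) * (2 * R + 2 * 0) ^ 2)) :=
      (((hlim.const_mul 2).const_add (2 * R)).pow 2).const_mul _
    have h1 := (Real.continuous_sqrt.tendsto 0).comp (hnum.div_atTop hden)
    rw [Real.sqrt_zero] at h1
    have h2 := h1.const_mul 3
    rw [mul_zero] at h2
    refine h2.congr' ?_
    filter_upwards [hlarge] with k hk
    have hk' : (0 : ℝ) < N k - a := by
      have : (a : ℝ) < N k := by exact_mod_cast hk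
      linarith
    have hh := hpos k
    rw [Nat.cast_sub hk.le, Function.comp_apply]
    congr 2
    rw [show (N k : ℝ) * h k ^ 2 + -(a * h k ^ 2) = (N k - a) * h k ^ 2 by ring]
    field_simp
  filter_upwards [hlarge, hQ.eventually (gt_mem_nhds (show 0 < θ / 4 by positivity)),
    (tendsto_gridBeta hX hS a (c := c) hpos hlim).eventually (Metric.ball_mem_nhds _ (half_pos hε))]
    with k hk hQk hgrid
  rw [Real.dist_eq, sub_zero, abs_of_nonneg measureReal_nonneg]
  have hsub : {ω | ε ≤ ‖betaHat X (c k) (h k) a (N k) ω - betaOne X P 0 a‖} ⊆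
      {ω | ε / 2 ≤ |betaHat X (c k) (h k) a (N k) ω - gridBeta X P (c k) (h k) a|} := by
    intro ω hω
    have hω' : ε ≤ |betaHat X (c k) (h k) a (N k) ω - betaOne X P 0 a| := hω
    rw [Real.dist_eq] at hgrid
    have := abs_sub_le (betaHat X (c k) (h k) a (N k) ω) (gridBeta X P (c k) (h k) a)
      (betaOne X P 0 a)
    simp only [mem_ofPred_eq]
    linarith
  refine ((measureReal_mono hsub).trans
    (real_le_abs_betaHat_sub_le hX hS a (c k) (hpos k) hk hR m (half_pos hε))).trans_lt ?_
  rw [div_lt_iff₀ (half_pos hε)]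
  change _ < θ
  linarith

end Consistency
end BetaMixing

/-! ### The theorem -/

theorem corollary1 {Ω : Type*} [MeasurableSpace Ω] (P : Measure Ω) [IsProbabilityMeasure P]
    (X : ℤ → Ω → ℝ) (hX : ∀ t, Measurable (X t))
    (hstat : BetaMixing.IsStationary X P) (hMarkov : BetaMixing.IsMarkov X P)
    (r : ℝ) (hr : 0 < r)
    (hbeta : (fun b : ℕ => BetaMixing.beta X P b) =O[atTop] (fun b : ℕ => (b : ℝ) ^ (-r)))
    (a : ℕ) (ha : 0 < a)
    (hdens : P.map (fun ω => (X 0 ω, X (a : ℤ) ω)) ≪ (volume : Measure (ℝ × ℝ)))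
    (c h : ℕ → ℝ) (hpos : ∀ n, 0 < h n) (hlim : Tendsto h atTop (𝓝 0)) :
    (∀ b : ℕ, 0 < b → ∀ t : ℤ, BetaMixing.beta X P b = BetaMixing.betaOne X P t b) ∧
    (Tendsto (fun n : ℕ => (n : ℝ) * h n ^ 2) atTop atTop →
      TendstoInMeasure P (fun (n : ℕ) (ω : Ω) => BetaMixing.betaHat X (c n) (h n) a n ω) atTop
        (fun _ => BetaMixing.beta X P a)) ∧
    (∀ N m μ : ℕ → ℕ,
      (∀ k, 0 < m k) → (∀ k, 0 < μ k) → (∀ k, 2 * μ k * m k = N k) →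
      (∀ k, (m k : ℝ) < (N k : ℝ) ^ (1 / (1 + r))) →
      Tendsto (fun k : ℕ => (μ k : ℝ) * h k ^ 2) atTop atTop →
      TendstoInMeasure P (fun (k : ℕ) (ω : Ω) => BetaMixing.betaHat X (c k) (h k) a (N k) ω) atTop
        (fun _ => BetaMixing.beta X P a)) := by
  have hβ : Tendsto (fun b : ℕ => BetaMixing.beta X P b) atTop (𝓝 0) :=
    hbeta.trans_tendsto ((tendsto_rpow_neg_atTop hr).comp tendsto_natCast_atTop_atTop)
  have hone := fun (b : ℕ) (t : ℤ) => BetaMixing.beta_eq_betaOne hX hstat hMarkov b t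
  refine ⟨fun b _ t => hone b t, fun hn => ?_, fun N m μ hm _ hN _ hμh => ?_⟩
  · rw [hone a 0]
    exact BetaMixing.tendstoInMeasure_betaHat hX hstat hβ a (N := fun n => n) hpos hlim hn
  · rw [hone a 0]
    refine BetaMixing.tendstoInMeasure_betaHat hX hstat hβ a hpos hlim
      (tendsto_atTop_mono (fun k => ?_) hμh)
    -- Since `N = 2 μ m` with `m ≥ 1`, divergence of `μ h²` forces that of `N h²`, the condition of
    -- the general result.
    have : μ k ≤ N k := by
      rw [← hN k]
      nlinarith [hm k]
    gcongr
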